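/- Let $c\in\mathbb C$ with $\mathrm{Re}(c)>0$, and let $H_c=-\frac{d^2}{dx^2}+cx^2$ be the complex harmonic oscillator in $L^2(\mathbb R)$, i.e. the m-sectorial operator associated with the closed form $Q_c(f,g)=\int f'\overline{g'}\,dx+c\int x^2f\overline g\,dx$ on $W^{1,2}(\mathbb R)\cap\{f\in L^2(\mathbb R):\int x^2|f(x)|^2dx<\infty\}$. With $\arg$ the principal argument, let $S_c$ be the set of $\tau\neq 0$ such that $-\frac\pi2\le\arg\tau\le\frac\pi2-\arg c$ if $\mathrm{Im}(c)>0$; $-\frac\pi2<\arg\tau<\frac\pi2$ if $\mathrm{Im}(c)=0$; $-\frac\pi2-\arg c\le\arg\tau\le\frac\pi2$ if $\mathrm{Im}(c)<0$. Let $e^{-H_c\tau}$, $\tau\in S_c$, denote the semigroup generated by $-H_c$: a family of operators that is a bounded holomorphic semigroup of contractions in the interior of $S_c$, is strongly continuous on $S_c$, and is such that for each $\tau\in S_c$ (edges included) $t\mapsto e^{-H_c t\tau}$, $t>0$, is the $C_0$-semigroup with generator $-\tau H_c$. (A bounded holomorphic semigroup of contractions in an open sector $\{a<\arg\tau<b\}$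 is a norm-holomorphic family of contractions $T_\tau$ with $T_{\tau_1+\tau_2}=T_{\tau_1}T_{\tau_2}$ and, for every $\varepsilon>0$, $T_\tau f\to f$ for all $f$ as $\tau\to0$ in $\{a+\varepsilon<\arg\tau<b-\varepsilon\}$.) Put $$\lambda=e^{-2c^{1/2}\tau},\quad w_1=\frac{c^{1/4}\lambda^{1/2}}{[\pi(1-\lambda^2)]^{1/2}},\quad w_2=\frac{c^{1/2}(1+\lambda^2)}{2(1-\lambda^2)},\quad w_3=\frac{2c^{1/2}\lambda}{1-\lambda^2},$$ where $\lambda^{1/2}$ means $e^{-c^{1/2}\tau}$ and all other fractional powers are principal, and let $K_c(\tau,x,y)=w_1\exp[w_3xy-w_2(x^2+y^2)]$. Theorem (non-self-adjoint Mehler formula). For every $c$ with $\mathrm{Re}(c)>0$ the semigroup $e^{-H_c\tau}$, $\tau\in S_c$, exists, and for all $\tau\in S_c$ and $f\in L^2(\mathbb R)$ the function $y\mapsto K_c(\tau,x,y)f(y)$ is integrable for every $x\in\mathbb R$, and $$e^{-H_c\tau}f(x)=\int_{\mathbb R}K_c(\tau,x,y)f(y)\,dy\qquad\text{for almost every }x\in\mathbb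 R .$$ Moreover $e^{-H_c\tau}$ is a Hilbert–Schmidt operator, hence compact, for every $\tau\in S_c$. -/

import Mathlib

open Filter Topology MeasureTheory
open scoped ComplexConjugate ContDiff

noncomputable section

namespace Oscillator

/-- The Hilbert space `L²(ℝ)` of complex-valued functions. -/
abbrev L2 : Type := Lp ℂ 2 (volume : Measure ℝ)

/-! ### The operator `H_c = -d²/dx² + c x²` -/

/-- `g ∈ L²(ℝ)` is the weak derivative of `f ∈ L²(ℝ)`. -/
def HasWeakDeriv (f g : L2) : Prop :=
  ∀ φ : ℝ → ℂ, ContDiff ℝ ∞ φ → HasCompactSupport φ →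
    ∫ x, f x * deriv φ x = -∫ x, g x * φ x

open Classical in
/-- The weak derivative of `f` when it exists in `L²(ℝ)` (it is then unique), and `0` otherwise. -/
def weakDeriv (f : L2) : L2 :=
  if h : ∃ g, HasWeakDeriv f g then h.choose else 0

/-- The form domain `W^{1,2}(ℝ) ∩ {f ∈ L²(ℝ) : ∫ x² |f(x)|² dx < ∞}`. -/
def formDomain : Set L2 :=
  {f | (∃ g, HasWeakDeriv f g) ∧ MemLp (fun x : ℝ => (x : ℂ) * f x) 2 volume}

/-- The sesquilinear form `Q_c(f, g) = ∫ f' conj(g') dx + c ∫ x² f conj(g) dx`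
(used on `formDomain`, where both integrands are integrable). -/
def form (c : ℂ) (f g : L2) : ℂ :=
  (∫ x : ℝ, weakDeriv f x * conj (weakDeriv g x)) +
    c * ∫ x : ℝ, (x : ℂ) ^ 2 * f x * conj (g x)

/-- The graph of `H_c`, the m-sectorial operator associated with the form `Q_c`:
`OscillatorGraph c f g` says that `f` lies in the domain of `H_c` and `H_c f = g`, that is,
`f` is in the form domain and `Q_c(f, v) = (g, v)` for all `v` in the form domain, where
`(g, v) = ∫ g conj(v) dx` (Mathlib's inner product is conjugate-linear on the left). -/
def OscillatorGraph (c : ℂ) (f g : L2) : Prop :=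
  f ∈ formDomain ∧ ∀ v ∈ formDomain, form c f v = inner ℂ v g

/-! ### One-parameter and holomorphic semigroups -/

/-- `U t`, `t > 0`, is a strongly continuous one-parameter semigroup whose infinitesimal generator
is the operator with graph `A` (equality of operators, domains included). -/
structure IsC0Semigroup {E : Type*} [NormedAddCommGroup E] [NormedSpace ℂ E]
    (U : ℝ → E →L[ℂ] E) (A : E → E → Prop) : Prop where
  add : ∀ s t : ℝ, 0 < s → 0 < t → U (s + t) = U s ∘L U t
  tendsto_zero : ∀ f : E, Tendsto (fun t => U t f) (𝓝[>] 0) (𝓝 f)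
  generator : ∀ f g : E,
    A f g ↔ Tendsto (fun t : ℝ => ((t : ℂ)⁻¹) • (U t f - f)) (𝓝[>] 0) (𝓝 g)

/-- The open sector `S(a, b) = {z : a < arg z < b}`, without the vertex. -/
def openSector (a b : ℝ) : Set ℂ :=
  {z | z ≠ 0 ∧ a < z.arg ∧ z.arg < b}

/-- `T` is a bounded holomorphic semigroup of contractions in the sector `S(a, b)`. -/
structure IsBoundedHolomorphicSemigroup {E : Type*} [NormedAddCommGroup E] [NormedSpace ℂ E]
    (a b : ℝ) (T : ℂ → E →L[ℂ] E) : Prop where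
  add : ∀ z ∈ openSector a b, ∀ w ∈ openSector a b, T (z + w) = T z ∘L T w
  contraction : ∀ z ∈ openSector a b, ‖T z‖ ≤ 1
  holomorphic : DifferentiableOn ℂ T (openSector a b)
  tendsto_zero : ∀ f : E, ∀ ε : ℝ, 0 < ε →
    Tendsto (fun z => T z f) (𝓝[openSector (a + ε) (b - ε)] 0) (𝓝 f)

/-! ### The maximal sector `S_c` and the semigroup `e^{-H_c τ}` -/

/-- Lower angle of `S_c`: it is `-π/2` if `Im c ≥ 0`, and `-π/2 - arg c` if `Im c < 0`. -/
def lowerAngle (c : ℂ) : ℝ := -(Real.pi / 2) - min c.arg 0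

/-- Upper angle of `S_c`: it is `π/2 - arg c` if `Im c > 0`, and `π/2` if `Im c ≤ 0`. -/
def upperAngle (c : ℂ) : ℝ := Real.pi / 2 - max c.arg 0

/-- The maximal sector `S_c`: for `Im c ≠ 0` the closed sector (without the vertex `0`)
between the two angles, for `Im c = 0` the open sector `|arg τ| < π/2`. -/
def sector (c : ℂ) : Set ℂ :=
  if c.im = 0 then openSector (lowerAngle c) (upperAngle c)
  else {τ | τ ≠ 0 ∧ lowerAngle c ≤ τ.arg ∧ τ.arg ≤ upperAngle c}

/-- `T τ = e^{-H_c τ}` for `τ ∈ S_c`: in the interior of `S_c`, `T` is a bounded holomorphic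
semigroup of contractions; along each ray of `S_c` (the positive half-axis and the edges
included) `t ↦ T (t τ)` is the one-parameter semigroup generated by `-τ H_c`; and `T` is strongly
continuous on all of `S_c`. The values of `T` off `S_c` are irrelevant. -/
structure IsOscillatorSemigroup (c : ℂ) (T : ℂ → L2 →L[ℂ] L2) : Prop where
  holomorphicSemigroup : IsBoundedHolomorphicSemigroup (lowerAngle c) (upperAngle c) T
  generator : ∀ τ ∈ sector c,
    IsC0Semigroup (fun t : ℝ => T ((t : ℂ) * τ))
      (fun f g => ∃ h, OscillatorGraph c f h ∧ g = (-τ) • h)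
  strongContinuous : ∀ f : L2, ContinuousOn (fun τ => T τ f) (sector c)

/-! ### The Mehler kernel -/

/-- `λ = exp(-2 c^{1/2} τ)` (`c^{1/2}` the principal root). -/
def lam (c τ : ℂ) : ℂ := Complex.exp (-2 * c ^ (1 / 2 : ℂ) * τ)

/-- `w₁ = c^{1/4} λ^{1/2} [π (1 - λ²)]^{-1/2}`. Here `λ^{1/2}` is the branch
`exp(-c^{1/2} τ)`, holomorphic in `τ` and positive for positive `c` and `τ`; the other powers are
principal (`Re c > 0`, and `|λ| < 1` on `S_c`). -/
def w₁ (c τ : ℂ) : ℂ :=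
  c ^ (1 / 4 : ℂ) * Complex.exp (-(c ^ (1 / 2 : ℂ)) * τ) *
    ((Real.pi : ℂ) * (1 - lam c τ ^ 2)) ^ (-(1 / 2) : ℂ)

/-- `w₂ = c^{1/2} (1 + λ²) / (2 (1 - λ²))`. -/
def w₂ (c τ : ℂ) : ℂ :=
  c ^ (1 / 2 : ℂ) * (1 + lam c τ ^ 2) / (2 * (1 - lam c τ ^ 2))

/-- `w₃ = 2 c^{1/2} λ / (1 - λ²)`. -/
def w₃ (c τ : ℂ) : ℂ :=
  2 * c ^ (1 / 2 : ℂ) * lam c τ / (1 - lam c τ ^ 2)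

/-- `K_c(τ, x, y) = w₁ exp[w₃ x y - w₂ (x² + y²)]`. -/
def kernel (c τ : ℂ) (x y : ℝ) : ℂ :=
  w₁ c τ * Complex.exp (w₃ c τ * x * y - w₂ c τ * ((x : ℂ) ^ 2 + (y : ℂ) ^ 2))

/-! ### Hilbert–Schmidt operators -/

/-- `T` is Hilbert–Schmidt: `∑ ‖T e_i‖² < ∞` for every orthonormal (Hilbert) basis `(e_i)`. -/
def IsHilbertSchmidt {E : Type} [NormedAddCommGroup E] [InnerProductSpace ℂ E]
    (T : E →L[ℂ] E) : Prop :=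
  ∀ (ι : Type) (e : HilbertBasis ι ℂ E), Summable fun i => ‖T (e i)‖ ^ 2

end Oscillator

end

/-! The semigroup is constructed from the kernel and then shown to be the only one. The set
`admissible c` contains `S_c` and is cut out by Re τ ≥ 0, Re(cτ) ≥ 0, Re(c^{1/2}τ) > 0. On it |Re
w₃| < 2 Re w₂ (`abs_w₃_re_lt`), so the kernel is dominated by a product of real Gaussians and its
integral operator is Hilbert–Schmidt (`exists_kernelOperator`).

The remaining properties are read off from the functions G_b = exp(-c^{1/2}x²/2 + bx), b complex,
whose span is dense (`dense_span_gauss`). The kernel sends G_b to an explicit multiple of G_{λb}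
(`integral_kernel_mul_gaussFun`); this expression is entire in τ and solves F' = -H_c F
(`exists_isEntireOrbit_gauss`). Multiplicativity of λ gives the semigroup law. Since Re⟨f, -τH_c f⟩
= -(Re τ ‖f'‖² + Re(cτ) ‖xf‖²) ≤ 0, norms decrease along rays, so the operators are contractions,
and density carries strong continuity up to 0 and holomorphy over from the Gaussian orbits.

The generator is identified abstractly (`isC0Semigroup_of_classicalOrbits`): for a closed
dissipative A, a dense set of initial values of classical orbits forces 1 - A to be onto, which
leaves no room between A and the generator. For uniqueness, any semigroup generated by -τH_c must
follow the explicit Gaussian orbits (`IsC0Semigroup.apply_eq`), hence agrees with the kernel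
operator on a dense set. -/

namespace Oscillator

/-! ### Dissipative operators, classical orbits and generators. -/

section Abstract

variable {E : Type*} [NormedAddCommGroup E] [InnerProductSpace ℂ E]

/-- A curve whose right derivative points inwards has nonincreasing norm. -/
theorem norm_le_of_dissipative {u u' : ℝ → E} (hc : ContinuousOn u (Set.Ici 0))
    (hd : ∀ t, 0 < t → HasDerivWithinAt u (u' t) (Set.Ici t) t)
    (hre : ∀ t, 0 < t → (inner ℂ (u t) (u' t)).re ≤ 0) {t : ℝ} (ht : 0 ≤ t) :
    ‖u t‖ ≤ ‖u 0‖ := by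
  -- The derivative is only available for positive times, so the comparison starts at a > 0 and
  -- continuity at 0 lets a → 0.
  have key : ∀ a, 0 < a → a ≤ t → ‖u t‖ ^ 2 ≤ ‖u a‖ ^ 2 := by
    intro a ha hat
    refine image_le_of_deriv_right_le_deriv_boundary (f := fun t => ‖u t‖ ^ 2)
      (f' := fun t => 2 * (inner ℂ (u t) (u' t)).re) (B := fun _ => ‖u a‖ ^ 2) (B' := fun _ => 0)
      ?_ ?_ le_rfl continuousOn_const (fun x _ => hasDerivWithinAt_const _ _ _) ?_
      (Set.right_mem_Icc.2 hat)
    · exact ((hc.mono fun x hx => ha.le.trans hx.1).norm).pow 2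
    · intro x hx
      have h1 := hd x (ha.trans_le hx.1)
      have h2 := (Complex.reCLM.hasFDerivAt.comp_hasDerivWithinAt x (h1.inner ℂ h1))
      convert! h2 using 1
      · ext y; simp [inner_self_eq_norm_sq_to_K, ← Complex.ofReal_pow]
      · have := inner_re_symm (𝕜 := ℂ) (u x) (u' x)
        simp only [RCLike.re_to_complex] at this
        simp [this]; ring
    · intro x hx
      have := hre x (ha.trans_le hx.1)
      linarith
  rcases ht.eq_or_lt with rfl | ht
  · exact le_rfl
  have h1 : Tendsto (fun a => ‖u a‖ ^ 2) (𝓝[>] 0) (𝓝 (‖u 0‖ ^ 2)) :=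
    (((hc 0 Set.self_mem_Ici).mono Set.Ioi_subset_Ici_self).norm).pow 2
  have h2 : ‖u t‖ ^ 2 ≤ ‖u 0‖ ^ 2 := by
    refine ge_of_tendsto h1 ?_
    filter_upwards [Ioc_mem_nhdsGT ht] with a ha using key a ha.1 ha.2
  exact (pow_le_pow_iff_left₀ (norm_nonneg _) (norm_nonneg _) two_ne_zero).1 h2

/-- `u` is a classical solution of `u' = A u`, `t ≥ 0`, given by the operators `U t`. -/
structure IsClassicalOrbit (U : ℝ → E →L[ℂ] E) (A : Submodule ℂ (E × E)) (u u' : ℝ → E) :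
    Prop where
  eq : ∀ t, 0 < t → u t = U t (u 0)
  hasDerivAt : ∀ t, 0 ≤ t → HasDerivAt u (u' t) t
  mem : ∀ t, 0 ≤ t → (u t, u' t) ∈ A

namespace IsClassicalOrbit

variable {U : ℝ → E →L[ℂ] E} {A : Submodule ℂ (E × E)} {u u' v v' : ℝ → E}

theorem add (hu : IsClassicalOrbit U A u u') (hv : IsClassicalOrbit U A v v') :
    IsClassicalOrbit U A (u + v) (u' + v') where
  eq t ht := by simp [hu.eq t ht, hv.eq t ht]
  hasDerivAt t ht := (hu.hasDerivAt t ht).add (hv.hasDerivAt t ht)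
  mem t ht := A.add_mem (hu.mem t ht) (hv.mem t ht)

theorem smul (a : ℂ) (hu : IsClassicalOrbit U A u u') :
    IsClassicalOrbit U A (a • u) (a • u') where
  eq t ht := by simp [hu.eq t ht]
  hasDerivAt t ht := (hu.hasDerivAt t ht).const_smul a
  mem t ht := A.smul_mem a (hu.mem t ht)

theorem shift (hadd : ∀ s t : ℝ, 0 < s → 0 < t → U (s + t) = U s ∘L U t)
    (hu : IsClassicalOrbit U A u u') {r : ℝ} (hr : 0 ≤ r) :
    IsClassicalOrbit U A (fun t => u (t + r)) (fun t => u' (t + r)) where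
  eq t ht := by
    rcases hr.eq_or_lt with rfl | hr
    · simpa using hu.eq t ht
    · rw [hu.eq _ (by linarith), zero_add, hu.eq r hr, hadd t r ht hr]; rfl
  hasDerivAt t ht := (hu.hasDerivAt (t + r) (by linarith)).comp_add_const t r
  mem t ht := hu.mem _ (by linarith)

/-- The identity u(h + t) = U_t u(h) is known only for h ≥ 0, so right derivatives at h = 0 are
compared; they are unique on a half-line. -/
theorem deriv_eq (hadd : ∀ s t : ℝ, 0 < s → 0 < t → U (s + t) = U s ∘L U t)
    (hu : IsClassicalOrbit U A u u') {t : ℝ} (ht : 0 < t) : u' t = U t (u' 0) := by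
  have h1 : HasDerivWithinAt (fun h => u (h + t)) (u' t) (Set.Ici 0) 0 := by
    have := (hu.shift hadd ht.le).hasDerivAt 0 le_rfl
    simpa using this.hasDerivWithinAt (s := Set.Ici 0)
  have h2 : HasDerivWithinAt (fun h => U t (u h)) (U t (u' 0)) (Set.Ici 0) 0 :=
    ((U t).restrictScalars ℝ).hasFDerivAt.comp_hasDerivWithinAt 0
      (hu.hasDerivAt 0 le_rfl).hasDerivWithinAt
  have h3 : ∀ h ∈ Set.Ici (0 : ℝ), U t (u h) = u (h + t) := by
    intro h hh
    rcases (Set.mem_Ici.1 hh).eq_or_lt with rfl | hh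
    · rw [zero_add, hu.eq t ht]
    · rw [hu.eq h hh, hu.eq (h + t) (by linarith), add_comm, hadd t h ht hh]; rfl
  exact (uniqueDiffOn_Ici (0 : ℝ) 0 Set.self_mem_Ici).eq_deriv _ h1
    (h2.congr (fun h hh => (h3 h hh).symm) (h3 0 Set.self_mem_Ici).symm)

theorem norm_le (hdiss : ∀ p ∈ A, (inner ℂ p.1 p.2).re ≤ 0)
    (hu : IsClassicalOrbit U A u u') {t : ℝ} (ht : 0 ≤ t) : ‖u t‖ ≤ ‖u 0‖ :=
  norm_le_of_dissipative (fun s hs => (hu.hasDerivAt s hs).continuousAt.continuousWithinAt)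
    (fun s hs => (hu.hasDerivAt s hs.le).hasDerivWithinAt)
    (fun s hs => hdiss _ (hu.mem s hs.le)) ht

end IsClassicalOrbit

/-- Pair f - g with f. For dissipative A this makes 1 - A injective with contractive inverse on its
range. -/
theorem norm_le_norm_sub_of_dissipative {f g : E} (h : (inner ℂ f g).re ≤ 0) :
    ‖f‖ ≤ ‖f - g‖ := by
  rcases eq_or_ne f 0 with rfl | hf
  · simp
  have h1 : ‖f‖ * ‖f‖ ≤ ‖f‖ * ‖f - g‖ := by
    calc ‖f‖ * ‖f‖ ≤ (inner ℂ f (f - g)).re := by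
          rw [inner_sub_right, Complex.sub_re, inner_self_eq_norm_sq_to_K]
          simp only [Complex.coe_algebraMap, ← Complex.ofReal_pow, Complex.ofReal_re]
          nlinarith
      _ ≤ ‖inner ℂ f (f - g)‖ := Complex.re_le_norm _
      _ ≤ _ := norm_inner_le_norm _ _
  exact le_of_mul_le_mul_left h1 (norm_pos_iff.2 hf)

/-- A contraction semigroup whose classical orbits for a closed dissipative operator `A` start at
a dense set of points is generated by `A`. -/
theorem isC0Semigroup_of_classicalOrbits [CompleteSpace E] {U : ℝ → E →L[ℂ] E}
    {A : Submodule ℂ (E × E)}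
    (hadd : ∀ s t : ℝ, 0 < s → 0 < t → U (s + t) = U s ∘L U t)
    (hcontr : ∀ t, 0 < t → ‖U t‖ ≤ 1)
    (hzero : ∀ f : E, Tendsto (fun t => U t f) (𝓝[>] 0) (𝓝 f))
    (hdiss : ∀ p ∈ A, (inner ℂ p.1 p.2).re ≤ 0)
    (hclosed : IsClosed (A : Set (E × E)))
    (hdense : Dense {f : E | ∃ u u', IsClassicalOrbit U A u u' ∧ u 0 = f}) :
    IsC0Semigroup U (fun f g => (f, g) ∈ A) := by
  have hcontr' : ∀ t, 0 < t → ∀ f, ‖U t f‖ ≤ ‖f‖ := fun t ht f => by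
    simpa using (U t).le_of_opNorm_le (hcontr t ht) f
  -- The image under 1 - A of the initial values of classical orbits.
  let R : Submodule ℂ E :=
    { carrier := {h | ∃ u u', IsClassicalOrbit U A u u' ∧ u 0 - u' 0 = h}
      add_mem' := by
        rintro _ _ ⟨u, u', hu, rfl⟩ ⟨v, v', hv, rfl⟩
        exact ⟨_, _, hu.add hv, by simp; abel⟩
      zero_mem' := ⟨0, 0, ⟨by simp, fun t _ => hasDerivAt_const t 0, fun _ _ => A.zero_mem⟩,
        by simp⟩
      smul_mem' := by
        rintro a _ ⟨u, u', hu, rfl⟩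
        exact ⟨_, _, hu.smul a, by simp [smul_sub]⟩ }
  have hR : R.topologicalClosure = ⊤ := by
    rw [Submodule.topologicalClosure_eq_top_iff, Submodule.eq_bot_iff]
    intro g hg
    -- Shifted orbits also start in the domain, so g ⟂ R gives ⟨g, u'⟩ = ⟨g, u⟩ at all times and
    -- e^{-t}⟨g, u(t)⟩ is constant. As u is bounded, that constant is 0.
    have horth : ∀ u u', IsClassicalOrbit U A u u' → inner ℂ (u 0) g = 0 := by
      intro u u' hu
      have hw : ∀ t, 0 ≤ t → inner ℂ g (u' t) = inner ℂ g (u t) := by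
        intro t ht
        have := Submodule.inner_left_of_mem_orthogonal
          (show u t - u' t ∈ R from ⟨_, _, hu.shift hadd ht, by simp⟩) hg
        rw [inner_sub_right, sub_eq_zero] at this
        exact this.symm
      have hd : ∀ t, 0 ≤ t → HasDerivAt (fun t : ℝ => Real.exp (-t) • inner ℂ g (u t)) 0 t := by
        intro t ht
        have h1 : HasDerivAt (fun t => inner ℂ g (u t)) (inner ℂ g (u' t)) t := by
          simpa using (hasDerivAt_const t g).inner ℂ (hu.hasDerivAt t ht)
        have h2 := (hasDerivAt_neg t).exp.smul h1
        rw [hw t ht] at h2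
        convert! h2 using 1
        simp
      have hconst : ∀ t, 0 ≤ t → Real.exp (-t) • inner ℂ g (u t) = inner ℂ g (u 0) := by
        intro t ht
        have := constant_of_has_deriv_right_zero (a := 0) (b := t)
          (f := fun t : ℝ => Real.exp (-t) • inner ℂ g (u t))
          (fun s hs => (hd s hs.1).continuousAt.continuousWithinAt)
          (fun s hs => (hd s hs.1).hasDerivWithinAt) t (Set.right_mem_Icc.2 ht)
        simpa using this
      have hb : ∀ t, 0 ≤ t → ‖inner ℂ g (u 0)‖ ≤ Real.exp (-t) * (‖g‖ * ‖u 0‖) := by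
        intro t ht
        rw [← hconst t ht, norm_smul, Real.norm_eq_abs, Real.abs_exp]
        gcongr
        exact (norm_inner_le_norm _ _).trans (by gcongr; exact hu.norm_le hdiss ht)
      have hlim : Tendsto (fun t => Real.exp (-t) * (‖g‖ * ‖u 0‖)) atTop (𝓝 0) := by
        simpa using (Real.tendsto_exp_neg_atTop_nhds_zero).mul_const (‖g‖ * ‖u 0‖)
      have h0 : ‖inner ℂ g (u 0)‖ ≤ 0 := ge_of_tendsto hlim
        ((eventually_ge_atTop 0).mono hb)
      rw [← inner_conj_symm, norm_le_zero_iff.1 h0, map_zero]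
    refine hdense.eq_zero_of_inner_right ℂ ?_
    rintro _ ⟨u, u', hu, rfl⟩
    exact horth u u' hu
  -- Every h is (1 - A)f for a pair (f, g) lying both in A and in the generator: approximate h from
  -- R, where the preimages form a Cauchy sequence by dissipativity, and use closedness of A.
  have hsolve : ∀ h : E, ∃ f g, f - g = h ∧ (f, g) ∈ A ∧
      Tendsto (fun t : ℝ => ((t : ℂ)⁻¹) • (U t f - f)) (𝓝[>] 0) (𝓝 g) := by
    intro h
    have hh : h ∈ closure (R : Set E) := by
      rw [← Submodule.topologicalClosure_coe, hR]; trivial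
    obtain ⟨r, hr, hrh⟩ := mem_closure_iff_seq_limit.1 hh
    choose u u' hu hur using hr
    have hle : ∀ n m, dist (u n 0) (u m 0) ≤ dist (r n) (r m) := by
      intro n m
      rw [dist_eq_norm, dist_eq_norm, ← hur, ← hur]
      refine (norm_le_norm_sub_of_dissipative
        (hdiss _ (A.sub_mem ((hu n).mem 0 le_rfl) ((hu m).mem 0 le_rfl)))).trans_eq ?_
      congr 1
      simp only [Prod.fst_sub, Prod.snd_sub]
      abel
    have hcau : CauchySeq fun n => u n 0 := by
      rw [Metric.cauchySeq_iff]
      intro ε hε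
      obtain ⟨N, hN⟩ := Metric.cauchySeq_iff.1 hrh.cauchySeq ε hε
      exact ⟨N, fun m hm n hn => (hle m n).trans_lt (hN m hm n hn)⟩
    obtain ⟨f, hf⟩ := cauchySeq_tendsto_of_complete hcau
    have hg : Tendsto (fun n => u' n 0) atTop (𝓝 (f - h)) := by
      refine (hf.sub hrh).congr fun n => ?_
      rw [← hur n]; abel
    refine ⟨f, f - h, by abel, hclosed.mem_of_tendsto (hf.prodMk_nhds hg)
      (Eventually.of_forall fun n => (hu n).mem 0 le_rfl), ?_⟩
    generalize f - h = g at hg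
    rw [Metric.tendsto_nhds]
    intro ε hε
    obtain ⟨δ, hδ, hδ'⟩ := mem_nhdsGT_iff_exists_Ioo_subset.1
      (Metric.tendsto_nhds.1 (hzero g) (ε / 2) (half_pos hε))
    filter_upwards [Ioo_mem_nhdsGT hδ] with t ht
    -- Mean value inequality for u_n(s) - s g. The choice of t does not depend on n, so n → ∞ bounds
    -- the difference quotient of the limit f.
    have hbound : ∀ n, ‖U t (u n 0) - t • g - u n 0‖ ≤ (‖u' n 0 - g‖ + ε / 2) * (t - 0) := by
      intro n
      have := norm_image_sub_le_of_norm_deriv_right_le_segment (a := 0) (b := t)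
        (f := fun s => u n s - s • g) (f' := fun s => u' n s - g) (C := ‖u' n 0 - g‖ + ε / 2)
        (fun s hs => (((hu n).hasDerivAt s hs.1).continuousAt.sub
          (by fun_prop)).continuousWithinAt)
        (fun s hs => by
          have h1 := ((hu n).hasDerivAt s hs.1).sub ((hasDerivAt_id s).smul_const g)
          rw [one_smul] at h1
          exact h1.hasDerivWithinAt)
        (fun s hs => by
          rcases hs.1.eq_or_lt with rfl | hs0
          · linarith
          · rw [(hu n).deriv_eq hadd hs0]
            have h1 : U s (u' n 0) - g = U s (u' n 0 - g) + (U s g - g) := by simp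
            rw [h1]
            refine (norm_add_le _ _).trans (add_le_add (hcontr' s hs0 _) ?_)
            have := hδ' ⟨hs0, hs.2.trans ht.2⟩
            simp only [Set.mem_ofPred_eq, dist_eq_norm] at this
            exact this.le)
        t (Set.right_mem_Icc.2 ht.1.le)
      simpa [(hu n).eq t ht.1] using this
    have hlim : ‖U t f - t • g - f‖ ≤ (‖g - g‖ + ε / 2) * (t - 0) :=
      le_of_tendsto_of_tendsto
        (((((U t).continuous.tendsto f).comp hf).sub_const _).sub hf).norm
        (((hg.sub_const g).norm.add_const _).mul_const _)
        (Eventually.of_forall hbound)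
    have ht0 : (t : ℂ) ≠ 0 := by exact_mod_cast ht.1.ne'
    have h2 : ((t : ℂ)⁻¹) • (U t f - f) - g = ((t : ℂ)⁻¹) • (U t f - t • g - f) := by
      rw [sub_right_comm, smul_sub _ (U t f - f) (t • g), ← Complex.coe_smul t g,
        inv_smul_smul₀ ht0]
    rw [dist_eq_norm, h2, norm_smul, norm_inv, Complex.norm_real, Real.norm_of_nonneg ht.1.le]
    rw [sub_self, norm_zero, zero_add, sub_zero] at hlim
    calc t⁻¹ * ‖U t f - t • g - f‖ ≤ t⁻¹ * (ε / 2 * t) := by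
          have := ht.1; gcongr
      _ = ε / 2 := by have := ht.1.ne'; field_simp
      _ < ε := half_lt_self hε
  have hB : ∀ f g, Tendsto (fun t : ℝ => ((t : ℂ)⁻¹) • (U t f - f)) (𝓝[>] 0) (𝓝 g) →
      (inner ℂ f g).re ≤ 0 := by
    intro f g hfg
    have h1 : Tendsto (fun t : ℝ => (inner ℂ f (((t : ℂ)⁻¹) • (U t f - f))).re) (𝓝[>] 0)
        (𝓝 (inner ℂ f g).re) :=
      (Complex.continuous_re.tendsto _).comp (tendsto_const_nhds.inner hfg)
    refine le_of_tendsto h1 ?_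
    filter_upwards [self_mem_nhdsWithin] with t ht
    rw [inner_smul_right, ← Complex.ofReal_inv, Complex.re_ofReal_mul]
    refine mul_nonpos_of_nonneg_of_nonpos (inv_nonneg.2 (le_of_lt ht)) ?_
    rw [inner_sub_right, Complex.sub_re, inner_self_eq_norm_sq_to_K]
    simp only [Complex.coe_algebraMap, ← Complex.ofReal_pow, Complex.ofReal_re]
    have h3 : (inner ℂ f (U t f)).re ≤ ‖f‖ * ‖f‖ :=
      (Complex.re_le_norm _).trans ((norm_inner_le_norm _ _).trans (by
        gcongr; exact hcontr' t ht f))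
    nlinarith
  -- A and the generator are both dissipative, so any pair in either one coincides with the common
  -- pair supplied by `hsolve`.
  have huniq : ∀ f g f₀ g₀ : E, f - g = f₀ - g₀ → (inner ℂ (f - f₀) (g - g₀)).re ≤ 0 →
      f = f₀ ∧ g = g₀ := by
    intro f g f₀ g₀ h h1
    have h2 := norm_le_norm_sub_of_dissipative h1
    have h3 : f - f₀ - (g - g₀) = 0 := by
      have : f - f₀ - (g - g₀) = (f - g) - (f₀ - g₀) := by abel
      rw [this, h, sub_self]
    rw [h3, norm_zero] at h2
    have h4 := sub_eq_zero.1 (norm_le_zero_iff.1 h2)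
    subst h4
    exact ⟨rfl, by simpa using h⟩
  refine ⟨hadd, hzero, fun f g => ⟨fun h => ?_, fun h => ?_⟩⟩
  · obtain ⟨f₀, g₀, h1, h2, h3⟩ := hsolve (f - g)
    obtain ⟨rfl, rfl⟩ := huniq f g f₀ g₀ h1.symm (hdiss _ (A.sub_mem h h2))
    exact h3
  · obtain ⟨f₀, g₀, h1, h2, h3⟩ := hsolve (f - g)
    obtain ⟨rfl, rfl⟩ := huniq f g f₀ g₀ h1.symm (hB _ _ (by
      refine (h.sub h3).congr fun t => ?_
      rw [← smul_sub, map_sub]; congr 1; abel))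
    exact h2

/-- A semigroup generated by a dissipative operator `A` gives the classical solutions
of `u' = A u`. -/
theorem IsC0Semigroup.apply_eq {V : ℝ → E →L[ℂ] E} {A : Submodule ℂ (E × E)}
    (hV : IsC0Semigroup V (fun f g => (f, g) ∈ A))
    (hcont : ∀ f, ContinuousOn (fun t => V t f) (Set.Ioi 0))
    (hdiss : ∀ p ∈ A, (inner ℂ p.1 p.2).re ≤ 0) {u u' : ℝ → E}
    (hu : ∀ t, 0 ≤ t → HasDerivAt u (u' t) t) (hA : ∀ t, 0 ≤ t → (u t, u' t) ∈ A)
    {t : ℝ} (ht : 0 < t) : V t (u 0) = u t := by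
  classical
  -- The value of V at 0 is unspecified, so the initial value is inserted by hand. The curve v - u
  -- starts at 0 and its right derivative comes from A, hence it stays 0; V itself need not be
  -- assumed contractive.
  set v : ℝ → E := fun t => if 0 < t then V t (u 0) else u 0 with hv
  have hvpos : ∀ t, 0 < t → v t = V t (u 0) := fun t ht => by simp [hv, ht]
  have hv0 : v 0 = u 0 := by simp [hv]
  have hvc : ContinuousOn v (Set.Ici 0) := by
    intro s hs
    rcases (Set.mem_Ici.1 hs).eq_or_lt with rfl | hs
    · rw [← Set.Ioi_insert, continuousWithinAt_insert_self]
      change Tendsto v _ _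
      rw [hv0]
      refine (hV.tendsto_zero (u 0)).congr' ?_
      filter_upwards [self_mem_nhdsWithin] with t ht using (hvpos t ht).symm
    · refine ContinuousAt.continuousWithinAt ?_
      refine ((hcont (u 0)).continuousAt (Ioi_mem_nhds hs)).congr ?_
      filter_upwards [Ioi_mem_nhds hs] with t ht using (hvpos t ht).symm
  have hlim := (hV.generator _ _).1 (hA 0 le_rfl)
  have hvlim : ∀ t, 0 < t → Tendsto (fun h : ℝ => ((h : ℂ)⁻¹) • (V h (V t (u 0)) - V t (u 0)))
      (𝓝[>] 0) (𝓝 (V t (u' 0))) := by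
    intro t ht
    refine (((V t).continuous.tendsto _).comp hlim).congr' ?_
    filter_upwards [self_mem_nhdsWithin] with h hh
    have h1 : V t (V h (u 0)) = V h (V t (u 0)) := by
      rw [← ContinuousLinearMap.comp_apply, ← ContinuousLinearMap.comp_apply, ← hV.add t h ht hh,
        ← hV.add h t hh ht, add_comm]
    simp [h1]
  have hvd : ∀ t, 0 < t → HasDerivWithinAt v (V t (u' 0)) (Set.Ici t) t := by
    intro t ht
    rw [← hasDerivWithinAt_Ioi_iff_Ici, hasDerivWithinAt_iff_tendsto_slope' (by simp)]
    have h1 : Tendsto (fun x => x - t) (𝓝[>] t) (𝓝[>] 0) := by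
      refine tendsto_nhdsWithin_iff.2 ⟨?_, ?_⟩
      · have : Tendsto (fun x => x - t) (𝓝 t) (𝓝 (t - t)) := (continuous_sub_right t).tendsto t
        rw [sub_self] at this
        exact this.mono_left nhdsWithin_le_nhds
      · filter_upwards [self_mem_nhdsWithin] with x hx using sub_pos.2 (Set.mem_Ioi.1 hx)
    refine ((hvlim t ht).comp h1).congr' ?_
    filter_upwards [self_mem_nhdsWithin] with x hx
    have hx' : t < x := hx
    have h2 : V x (u 0) = V (x - t) (V t (u 0)) := by
      rw [← ContinuousLinearMap.comp_apply, ← hV.add _ _ (sub_pos.2 hx') ht, sub_add_cancel]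
    simp only [Function.comp, slope, vsub_eq_sub, hvpos x (ht.trans hx'), hvpos t ht, h2]
    rw [← Complex.ofReal_inv, Complex.coe_smul]
  have := norm_le_of_dissipative (u := fun s => v s - u s) (u' := fun s => V s (u' 0) - u' s)
    (hvc.sub fun s hs => (hu s hs).continuousAt.continuousWithinAt)
    (fun s hs => (hvd s hs).sub (hu s hs.le).hasDerivWithinAt)
    (fun s hs => by
      rw [hvpos s hs]
      exact hdiss _ (A.sub_mem ((hV.generator _ _).2 (hvlim s hs)) (hA s hs.le))) ht.le
  rw [hv0, sub_self, norm_zero, norm_le_zero_iff, sub_eq_zero, hvpos t ht] at this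
  exact this

end Abstract

/-! ### From strong to norm holomorphy. -/

section Holomorphy

variable {E F : Type*} [NormedAddCommGroup E] [NormedSpace ℂ E] [NormedAddCommGroup F]
  [NormedSpace ℂ F] [CompleteSpace F]

/-- A bounded strongly holomorphic family of operators is holomorphic in norm. -/
theorem differentiableOn_of_apply {U : Set ℂ} (hU : IsOpen U) {T : ℂ → E →L[ℂ] F} {C : ℝ}
    (hC : 0 ≤ C) (hb : ∀ z ∈ U, ‖T z‖ ≤ C)
    (hd : ∀ f, DifferentiableOn ℂ (fun z => T z f) U) : DifferentiableOn ℂ T U := by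
  have hcont : ContinuousOn T U := by
    intro w hw
    obtain ⟨ρ, hρ, hball⟩ := Metric.isOpen_iff.1 hU w hw
    -- Schwarz lemma: z ↦ T z f maps the ball of radius ρ into the ball of radius 2C‖f‖ about T w f.
    -- The bound is uniform in f, so T is norm continuous.
    have hle : ∀ z ∈ Metric.ball w ρ, ‖T z - T w‖ ≤ 2 * C / ρ * dist z w := by
      intro z hz
      refine ContinuousLinearMap.opNorm_le_bound _ (by positivity) fun f => ?_
      have := Complex.dist_le_div_mul_dist_of_mapsTo_ball (R₂ := 2 * C * ‖f‖)
        ((hd f).mono hball) (fun y hy => by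
          rw [Metric.mem_closedBall, dist_eq_norm]
          refine (norm_sub_le _ _).trans ?_
          have h1 := (T y).le_of_opNorm_le (hb y (hball hy)) f
          have h2 := (T w).le_of_opNorm_le (hb w hw) f
          linarith) hz
      rw [dist_eq_norm] at this
      rw [sub_apply]
      refine this.trans_eq ?_
      ring
    refine ContinuousAt.continuousWithinAt ?_
    rw [ContinuousAt, tendsto_iff_norm_sub_tendsto_zero]
    refine squeeze_zero' (Eventually.of_forall fun _ => norm_nonneg _)
      (eventually_of_mem (Metric.ball_mem_nhds w hρ) hle) ?_
    have : Tendsto (fun z => 2 * C / ρ * dist z w) (𝓝 w) (𝓝 (2 * C / ρ * dist w w)) :=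
      Continuous.tendsto (by fun_prop) w
    simpa using this
  intro z₀ hz₀
  obtain ⟨ρ, hρ, hball⟩ := Metric.isOpen_iff.1 hU z₀ hz₀
  set R : NNReal := ⟨ρ / 2, by positivity⟩ with hR
  have hR0 : 0 < R := by rw [← NNReal.coe_pos]; exact half_pos hρ
  have hsub : Metric.closedBall z₀ R ⊆ U :=
    (Metric.closedBall_subset_ball (half_lt_self hρ)).trans hball
  have hint : ContinuousOn T (Metric.sphere z₀ R) :=
    hcont.mono (Metric.sphere_subset_closedBall.trans hsub)
  -- The operator-valued Cauchy integral is analytic in norm; evaluated at each f it returns T w f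
  -- by the scalar-parameter Cauchy formula.
  have hser := hasFPowerSeriesOn_cauchy_integral (hint.circleIntegrable R.2) hR0
  have hG := (hser.analyticAt).differentiableAt
  refine (hG.congr_of_eventuallyEq ?_).differentiableWithinAt
  filter_upwards [Metric.ball_mem_nhds z₀ (NNReal.coe_pos.2 hR0)] with w hw
  ext f
  have h1 := Complex.two_pi_I_inv_smul_circleIntegral_sub_inv_smul_of_differentiable_on_off_countable
    (f := fun z => T z f) Set.countable_empty hw ((hd f).continuousOn.mono hsub)
    (fun x hx => (hd f).differentiableAt (hU.mem_nhds (hsub (Metric.ball_subset_closedBall hx.1))))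
  have hw0 : ContinuousOn (fun z => (z - w)⁻¹ • T z) (Metric.sphere z₀ R) := by
    refine ContinuousOn.smul (ContinuousOn.inv₀
      (continuous_sub_right w).continuousOn fun z hz h => ?_) hint
    rw [sub_eq_zero] at h
    subst h
    exact (Metric.mem_ball.1 hw).ne (Metric.mem_sphere.1 hz)
  have h2 : IntervalIntegrable
      (fun θ => deriv (circleMap z₀ R) θ • ((circleMap z₀ R θ - w)⁻¹ • T (circleMap z₀ R θ)))
      volume 0 (2 * Real.pi) := (hw0.circleIntegrable R.2).out
  rw [smul_apply, circleIntegral, ContinuousLinearMap.intervalIntegral_apply h2]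
  exact h1.symm

end Holomorphy

/-! ### Hilbert–Schmidt operators are compact. -/

section HilbertSchmidt

/-- The finite-rank truncations along a Hilbert basis converge in norm: Cauchy–Schwarz and Bessel
bound the tail by the tail of ∑ ‖T e_i‖². -/
theorem IsHilbertSchmidt.isCompactOperator {E : Type} [NormedAddCommGroup E]
    [InnerProductSpace ℂ E] [CompleteSpace E] {T : E →L[ℂ] E} (hT : IsHilbertSchmidt T) :
    IsCompactOperator T := by
  classical
  obtain ⟨w, e, -⟩ := exists_hilbertBasis ℂ E
  have hs := hT w e
  let P : w → E →L[ℂ] E := fun i => (innerSL ℂ (e i)).smulRight (T (e i))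
  have hP : ∀ s : Finset w, IsCompactOperator (∑ i ∈ s, P i : E →L[ℂ] E) := by
    intro s
    refine (compactOperator (RingHom.id ℂ) E E).sum_mem fun i _ => ?_
    exact ((isCompactOperator_id (E := ℂ)).comp_clm (innerSL ℂ (e i))).clm_comp
      (ContinuousLinearMap.toSpanSingleton ℂ (T (e i)))
  refine isCompactOperator_of_tendsto (l := (atTop : Filter (Finset w)))
    (F := fun s => ∑ i ∈ s, P i) ?_ (Eventually.of_forall hP)
  rw [Metric.tendsto_atTop]
  intro ε hε
  obtain ⟨s₀, hs₀⟩ := summable_iff_vanishing_norm.1 hs ((ε / 2) ^ 2) (by positivity)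
  refine ⟨s₀, fun s hs => ?_⟩
  rw [dist_comm, dist_eq_norm]
  refine lt_of_le_of_lt (ContinuousLinearMap.opNorm_le_bound _ (half_pos hε).le fun x => ?_)
    (half_lt_self hε)
  have hsum : HasSum (fun i => P i x) (T x) := by
    have := (e.hasSum_repr x).mapL T
    simpa [P, e.repr_apply_apply] using this
  refine le_of_tendsto ((Tendsto.sub_const hsum (∑ i ∈ s, P i x)).norm.congr fun t => ?_)
    (f := fun t : Finset w => ‖∑ i ∈ t, P i x - ∑ i ∈ s, P i x‖) ?_ |>.trans' ?_
  · rfl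
  · filter_upwards [eventually_ge_atTop s] with t hst
    rw [← Finset.sum_sdiff hst, add_sub_cancel_right]
    have h1 : ‖∑ i ∈ t \ s, P i x‖ ≤ ∑ i ∈ t \ s, ‖inner ℂ (e i) x‖ * ‖T (e i)‖ :=
      (norm_sum_le _ _).trans (Finset.sum_le_sum fun i _ => by simp [P, norm_smul])
    have h2 : (∑ i ∈ t \ s, ‖inner ℂ (e i) x‖ * ‖T (e i)‖) ^ 2 ≤ (ε / 2 * ‖x‖) ^ 2 := by
      refine (Finset.sum_mul_sq_le_sq_mul_sq _ _ _).trans ?_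
      rw [mul_comm, mul_pow]
      have h3 := hs₀ (t \ s) (Finset.disjoint_of_subset_right hs Finset.sdiff_disjoint)
      rw [Real.norm_of_nonneg (Finset.sum_nonneg fun _ _ => by positivity)] at h3
      gcongr
      exact e.orthonormal.sum_inner_products_le x
    exact h1.trans (abs_le_of_sq_le_sq' h2 (by positivity)).2
  · simp

end HilbertSchmidt

/-! ### Integral operators with dominated kernels. -/

section IntegralOperator

theorem norm_sq_eq_integral (f : L2) : ‖f‖ ^ 2 = ∫ x, ‖f x‖ ^ 2 := by
  have h : inner ℂ f f = ((∫ x, ‖f x‖ ^ 2 : ℝ) : ℂ) := by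
    rw [L2.inner_def, ← integral_complex_ofReal]
    simp [inner_self_eq_norm_sq_to_K]
  rw [inner_self_eq_norm_sq_to_K] at h
  have h1 := congrArg Complex.re h
  simpa [← Complex.ofReal_pow] using h1

theorem integrable_norm_sq (f : L2) : Integrable fun x => ‖f x‖ ^ 2 :=
  (memLp_two_iff_integrable_sq_norm (Lp.aestronglyMeasurable f)).1 (Lp.memLp f)

/-- An integral kernel dominated by `g ⊗ g` with `g ∈ L²` defines a Hilbert–Schmidt operator. -/
theorem exists_integralOperator {k : ℝ → ℝ → ℂ} (hk : Continuous (Function.uncurry k))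
    {g : ℝ → ℝ} (hg : MemLp g 2 volume) (hbd : ∀ x y, ‖k x y‖ ≤ g x * g y) :
    ∃ T : L2 →L[ℂ] L2, IsHilbertSchmidt T ∧ ∀ f : L2,
      (∀ x, Integrable (fun y => k x y * f y)) ∧ T f =ᵐ[volume] fun x => ∫ y, k x y * f y := by
  have hkx : ∀ x, Continuous (k x) := fun x => hk.comp (Continuous.prodMk_right x)
  have hmem : ∀ x, MemLp (fun y => conj (k x y)) 2 volume := fun x =>
    (hg.const_mul (g x)).of_le ((hkx x).star).aestronglyMeasurable
      (Eventually.of_forall fun y => by simpa using (hbd x y).trans (le_abs_self _))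
  -- The kernel row is conjugated because the inner product is conjugate-linear on the left.
  let κ : ℝ → L2 := fun x => (hmem x).toLp _
  have hinner : ∀ x (f : L2), inner ℂ (κ x) f = ∫ y, k x y * f y := by
    intro x f
    rw [L2.inner_def]
    refine integral_congr_ae ?_
    filter_upwards [(hmem x).coeFn_toLp] with y hy
    simp [κ, hy, mul_comm]
  set G : ℝ := ‖hg.toLp g‖ with hG
  have hκ : ∀ x, ‖κ x‖ ≤ G * ‖g x‖ := by
    intro x
    rw [mul_comm]
    refine Lp.norm_le_mul_norm_of_ae_le_mul ?_
    filter_upwards [(hmem x).coeFn_toLp, hg.coeFn_toLp] with y hy hy'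
    rw [hy, hy', RCLike.norm_conj, ← norm_mul]
    exact (hbd x y).trans (le_abs_self _)
  have hle : ∀ (f : L2) x, ‖∫ y, k x y * f y‖ ≤ G * ‖f‖ * ‖g x‖ := by
    intro f x
    rw [← hinner, mul_right_comm]
    exact (norm_inner_le_norm _ _).trans (by gcongr; exact hκ x)
  have hTmem : ∀ f : L2, MemLp (fun x => ∫ y, k x y * f y) 2 volume := by
    intro f
    refine (hg.const_mul (G * ‖f‖)).of_le ?_ (Eventually.of_forall fun x => ?_)
    · exact (hk.aestronglyMeasurable.mul (Lp.aestronglyMeasurable f).comp_snd).integral_prod_right'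
    · refine (hle f x).trans_eq ?_
      rw [norm_mul (G * ‖f‖), Real.norm_of_nonneg (r := G * ‖f‖) (by positivity)]
  let T₀ : L2 →ₗ[ℂ] L2 :=
    { toFun := fun f => (hTmem f).toLp _
      map_add' := fun f f' => by
        rw [← MemLp.toLp_add]
        refine MemLp.toLp_congr _ _ (Eventually.of_forall fun x => ?_)
        simp only [Pi.add_apply, ← hinner, inner_add_right]
      map_smul' := fun a f => by
        rw [RingHom.id_apply, ← MemLp.toLp_const_smul]
        refine MemLp.toLp_congr _ _ (Eventually.of_forall fun x => ?_)
        simp only [Pi.smul_apply, ← hinner, inner_smul_right, smul_eq_mul] }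
  have hT₀ : ∀ f, T₀ f =ᵐ[volume] fun x => ∫ y, k x y * f y := fun f => (hTmem f).coeFn_toLp
  let T : L2 →L[ℂ] L2 := T₀.mkContinuous (G * G) (fun f => by
    have : ‖T₀ f‖ ≤ G * ‖f‖ * ‖hg.toLp g‖ := by
      refine Lp.norm_le_mul_norm_of_ae_le_mul ?_
      filter_upwards [hT₀ f, hg.coeFn_toLp] with x hx hx'
      rw [hx, hx']
      exact hle f x
    linarith)
  refine ⟨T, fun ι e => ?_, fun f => ⟨fun x => ?_, hT₀ f⟩⟩
  -- Write ‖T e_i‖² as the integral over x of |⟨e_i, κ_x⟩|², apply Bessel to κ_x pointwise, and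
  -- integrate.
  · refine summable_of_sum_le (c := ∫ x, (G * ‖g x‖) ^ 2) (fun _ => by positivity) fun s => ?_
    have h1 : ∀ i, ‖T (e i)‖ ^ 2 = ∫ x, ‖inner ℂ (e i) (κ x)‖ ^ 2 := by
      intro i
      rw [norm_sq_eq_integral]
      refine integral_congr_ae ?_
      filter_upwards [hT₀ (e i)] with x hx
      change ‖T₀ (e i) x‖ ^ 2 = _
      rw [hx, ← hinner, norm_inner_symm]
    have h2 : ∀ i, Integrable fun x => ‖inner ℂ (e i) (κ x)‖ ^ 2 := by
      intro i
      refine (integrable_norm_sq (T₀ (e i))).congr ?_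
      filter_upwards [hT₀ (e i)] with x hx
      rw [hx, ← hinner, norm_inner_symm]
    simp only [h1]
    rw [← integral_finsetSum _ fun i _ => h2 i]
    refine integral_mono (integrable_finsetSum _ fun i _ => h2 i) ?_ fun x => ?_
    · have := (memLp_two_iff_integrable_sq_norm hg.1).1 hg
      simpa [mul_pow] using this.const_mul (G ^ 2)
    · refine (e.orthonormal.sum_inner_products_le (κ x)).trans ?_
      gcongr
      exact hκ x
  · have := (Lp.memLp f).integrable_mul (hmem x).star
    refine this.congr (Eventually.of_forall fun y => ?_)
    simp [mul_comm]

end IntegralOperator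

/-! ### Weak derivatives, the form domain and the graph of `H_c`. -/

section WeakDerivatives

theorem integrable_mul_of_memLp (f : L2) {φ : ℝ → ℂ} (hφ : MemLp φ 2 volume) :
    Integrable fun x => f x * φ x :=
  (Lp.memLp f).integrable_mul hφ

theorem integral_mul_eq_inner (f : L2) {φ : ℝ → ℂ} (hφ : MemLp φ 2 volume) :
    ∫ x, f x * φ x = inner ℂ (hφ.star.toLp _) f := by
  rw [L2.inner_def]
  refine integral_congr_ae ?_
  filter_upwards [hφ.star.coeFn_toLp] with x hx
  simp [hx]

theorem memLp_testFunction {φ : ℝ → ℂ} (hφ : ContDiff ℝ ∞ φ) (hs : HasCompactSupport φ) :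
    MemLp φ 2 volume :=
  hφ.continuous.memLp_of_hasCompactSupport hs

theorem memLp_deriv_testFunction {φ : ℝ → ℂ} (hφ : ContDiff ℝ ∞ φ) (hs : HasCompactSupport φ) :
    MemLp (deriv φ) 2 volume :=
  (hφ.continuous_deriv (by simp)).memLp_of_hasCompactSupport hs.deriv

theorem memLp_mul_testFunction {φ : ℝ → ℂ} (hφ : ContDiff ℝ ∞ φ) (hs : HasCompactSupport φ) :
    MemLp (fun x : ℝ => (x : ℂ) * φ x) 2 volume :=
  (Complex.continuous_ofReal.mul hφ.continuous).memLp_of_hasCompactSupport hs.mul_left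

/-- A locally integrable function vanishes if its integrals against test functions do. -/
theorem ae_eq_zero_of_forall_testFunction {h : ℝ → ℂ} (hh : LocallyIntegrable h volume)
    (H : ∀ φ : ℝ → ℂ, ContDiff ℝ ∞ φ → HasCompactSupport φ → ∫ x, h x * φ x = 0) :
    h =ᵐ[volume] 0 := by
  refine ae_eq_zero_of_integral_contDiff_smul_eq_zero hh fun g hg hgs => ?_
  have := H (fun x => (g x : ℂ)) (Complex.ofRealCLM.contDiff.comp hg)
    (hgs.comp_left Complex.ofReal_zero)
  rw [← this]
  exact integral_congr_ae (Eventually.of_forall fun x => by simp [mul_comm])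

/-- The triples `(f, f', x f)` in `L²`. -/
noncomputable def formGraph : Submodule ℂ (L2 × L2 × L2) where
  carrier := {p | ∀ φ : ℝ → ℂ, ContDiff ℝ ∞ φ → HasCompactSupport φ →
    ∫ x, p.1 x * deriv φ x = -∫ x, p.2.1 x * φ x ∧
    ∫ x : ℝ, p.1 x * (x * φ x) = ∫ x, p.2.2 x * φ x}
  add_mem' := by
    intro p q hp hq φ h1 h2
    have hp := hp φ h1 h2
    have hq := hq φ h1 h2
    simp only [Prod.fst_add, Prod.snd_add] at hp hq ⊢
    rw [integral_mul_eq_inner _ (memLp_deriv_testFunction h1 h2),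
      integral_mul_eq_inner _ (memLp_testFunction h1 h2),
      integral_mul_eq_inner _ (memLp_mul_testFunction h1 h2),
      integral_mul_eq_inner _ (memLp_testFunction h1 h2)] at hp hq ⊢
    simp only [inner_add_right, hp.1, hp.2, hq.1, hq.2, neg_add, and_self]
  zero_mem' := by
    intro φ h1 h2
    rw [integral_mul_eq_inner _ (memLp_deriv_testFunction h1 h2),
      integral_mul_eq_inner _ (memLp_testFunction h1 h2),
      integral_mul_eq_inner _ (memLp_mul_testFunction h1 h2),
      integral_mul_eq_inner _ (memLp_testFunction h1 h2)]
    simp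
  smul_mem' := by
    intro a p hp φ h1 h2
    have hp := hp φ h1 h2
    simp only [Prod.smul_fst, Prod.smul_snd] at hp ⊢
    rw [integral_mul_eq_inner _ (memLp_deriv_testFunction h1 h2),
      integral_mul_eq_inner _ (memLp_testFunction h1 h2),
      integral_mul_eq_inner _ (memLp_mul_testFunction h1 h2),
      integral_mul_eq_inner _ (memLp_testFunction h1 h2)] at hp ⊢
    simp only [inner_smul_right, hp.1, hp.2, mul_neg, and_self]

/-- Both relations, multiplication by x included, are tested weakly, so they are equalities of
continuous functionals. -/
theorem isClosed_formGraph : IsClosed (formGraph : Set (L2 × L2 × L2)) := by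
  have : (formGraph : Set (L2 × L2 × L2)) = ⋂ (φ : ℝ → ℂ) (h1 : ContDiff ℝ ∞ φ)
      (h2 : HasCompactSupport φ), {p | inner ℂ ((memLp_deriv_testFunction h1 h2).star.toLp _) p.1 =
        -inner ℂ ((memLp_testFunction h1 h2).star.toLp _) p.2.1 ∧
        inner ℂ ((memLp_mul_testFunction h1 h2).star.toLp _) p.1 =
        inner ℂ ((memLp_testFunction h1 h2).star.toLp _) p.2.2} := by
    ext p
    simp only [Set.mem_iInter]
    refine forall_congr' fun φ => forall_congr' fun h1 => forall_congr' fun h2 => ?_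
    rw [integral_mul_eq_inner _ (memLp_deriv_testFunction h1 h2),
      integral_mul_eq_inner _ (memLp_testFunction h1 h2),
      integral_mul_eq_inner _ (memLp_mul_testFunction h1 h2),
      integral_mul_eq_inner _ (memLp_testFunction h1 h2)]
    rfl
  rw [this]
  refine isClosed_iInter fun φ => isClosed_iInter fun h1 => isClosed_iInter fun h2 => ?_
  exact (isClosed_eq (by fun_prop) (by fun_prop)).inter (isClosed_eq (by fun_prop) (by fun_prop))

theorem mem_formGraph {f p q : L2} : (f, p, q) ∈ formGraph ↔
    HasWeakDeriv f p ∧ q =ᵐ[volume] fun x : ℝ => (x : ℂ) * f x := by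
  constructor
  · intro h
    refine ⟨fun φ h1 h2 => (h φ h1 h2).1, ?_⟩
    have hq : LocallyIntegrable q volume := (Lp.memLp q).locallyIntegrable one_le_two
    have hf : LocallyIntegrable (fun x : ℝ => (x : ℂ) * f x) volume := by
      have := (Lp.memLp f).locallyIntegrable one_le_two
      rw [← locallyIntegrableOn_univ] at this ⊢
      exact this.continuousOn_mul Complex.continuous_ofReal.continuousOn isOpen_univ.isLocallyClosed
    have h0 := ae_eq_zero_of_forall_testFunction (hq.sub hf) fun φ h1 h2 => by
      have h3 := (h φ h1 h2).2
      have h4 : ∀ x : ℝ, (⇑q - fun x : ℝ => (x : ℂ) * f x) x * φ x =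
          q x * φ x - f x * (x * φ x) := fun x => by simp; ring
      simp only [h4]
      rw [integral_sub (integrable_mul_of_memLp q (memLp_testFunction h1 h2))
        (integrable_mul_of_memLp f (memLp_mul_testFunction h1 h2)), sub_eq_zero]
      exact h3.symm
    filter_upwards [h0] with x hx
    exact sub_eq_zero.1 hx
  · rintro ⟨h1, h2⟩ φ h3 h4
    refine ⟨h1 φ h3 h4, integral_congr_ae ?_⟩
    filter_upwards [h2] with x hx
    simp only [hx]; ring

theorem HasWeakDeriv.unique {f g g' : L2} (h : HasWeakDeriv f g) (h' : HasWeakDeriv f g') :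
    g = g' := by
  have hl : ∀ q : L2, LocallyIntegrable q volume :=
    fun q => (Lp.memLp q).locallyIntegrable one_le_two
  have h0 := ae_eq_zero_of_forall_testFunction ((hl g).sub (hl g')) fun φ h1 h2 => by
    simp only [Pi.sub_apply, sub_mul]
    rw [integral_sub (integrable_mul_of_memLp g (memLp_testFunction h1 h2))
      (integrable_mul_of_memLp g' (memLp_testFunction h1 h2)), sub_eq_zero]
    exact neg_injective ((h φ h1 h2).symm.trans (h' φ h1 h2))
  refine Lp.ext ?_
  filter_upwards [h0] with x hx
  exact sub_eq_zero.1 hx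

theorem HasWeakDeriv.weakDeriv_eq {f g : L2} (h : HasWeakDeriv f g) : weakDeriv f = g := by
  have h' : ∃ g, HasWeakDeriv f g := ⟨g, h⟩
  rw [weakDeriv, dif_pos h']
  exact h'.choose_spec.unique h

theorem mem_formDomain_iff {f : L2} : f ∈ formDomain ↔ ∃ p q, (f, p, q) ∈ formGraph := by
  constructor
  · rintro ⟨⟨p, hp⟩, hq⟩
    exact ⟨p, hq.toLp _, mem_formGraph.2 ⟨hp, hq.coeFn_toLp⟩⟩
  · rintro ⟨p, q, h⟩
    obtain ⟨h1, h2⟩ := mem_formGraph.1 h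
    exact ⟨⟨p, h1⟩, (Lp.memLp q).ae_eq h2⟩

theorem form_eq (c : ℂ) {f p q v r s : L2} (hf : (f, p, q) ∈ formGraph)
    (hv : (v, r, s) ∈ formGraph) : form c f v = inner ℂ r p + c * inner ℂ s q := by
  obtain ⟨h1, h2⟩ := mem_formGraph.1 hf
  obtain ⟨h3, h4⟩ := mem_formGraph.1 hv
  rw [form, h1.weakDeriv_eq, h3.weakDeriv_eq, L2.inner_def, L2.inner_def]
  congr 2
  refine integral_congr_ae ?_
  filter_upwards [h2, h4] with x hx hx'
  simp [hx, hx']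
  ring

theorem oscillatorGraph_iff {c : ℂ} {f g : L2} : OscillatorGraph c f g ↔
    ∃ p q, (f, p, q) ∈ formGraph ∧ ∀ v r s, (v, r, s) ∈ formGraph →
      inner ℂ r p + c * inner ℂ s q = inner ℂ v g := by
  constructor
  · rintro ⟨h1, h2⟩
    obtain ⟨p, q, h⟩ := mem_formDomain_iff.1 h1
    exact ⟨p, q, h, fun v r s hv => by
      rw [← h2 v (mem_formDomain_iff.2 ⟨r, s, hv⟩), form_eq c h hv]⟩
  · rintro ⟨p, q, h, H⟩
    refine ⟨mem_formDomain_iff.2 ⟨p, q, h⟩, fun v hv => ?_⟩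
    obtain ⟨r, s, hv⟩ := mem_formDomain_iff.1 hv
    rw [form_eq c h hv, H v r s hv]

/-- The graph of `H_c` as a subspace of `L² × L²`. -/
noncomputable def oscillatorSubmodule (c : ℂ) : Submodule ℂ (L2 × L2) where
  carrier := {p | OscillatorGraph c p.1 p.2}
  add_mem' := by
    rintro ⟨f, g⟩ ⟨f', g'⟩ h h'
    obtain ⟨p, q, h1, h2⟩ := oscillatorGraph_iff.1 h
    obtain ⟨p', q', h1', h2'⟩ := oscillatorGraph_iff.1 h'
    refine oscillatorGraph_iff.2 ⟨p + p', q + q', formGraph.add_mem h1 h1', fun v r s hv => ?_⟩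
    simp only [inner_add_right, Prod.snd_add]
    linear_combination h2 v r s hv + h2' v r s hv
  zero_mem' := oscillatorGraph_iff.2 ⟨0, 0, formGraph.zero_mem, by simp⟩
  smul_mem' := by
    rintro a ⟨f, g⟩ h
    obtain ⟨p, q, h1, h2⟩ := oscillatorGraph_iff.1 h
    refine oscillatorGraph_iff.2 ⟨a • p, a • q, formGraph.smul_mem a h1, fun v r s hv => ?_⟩
    simp only [inner_smul_right, Prod.smul_snd]
    linear_combination a * h2 v r s hv

theorem mem_oscillatorSubmodule {c : ℂ} {f g : L2} :
    (f, g) ∈ oscillatorSubmodule c ↔ OscillatorGraph c f g := Iff.rfl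

/-- Testing H_c f = g against f itself gives ‖f'‖² + Re c ‖xf‖² ≤ ‖f‖‖g‖. Applied to differences,
graph convergence makes f' and xf converge too. -/
theorem isClosed_oscillatorSubmodule {c : ℂ} (hc : 0 < c.re) :
    IsClosed (oscillatorSubmodule c : Set (L2 × L2)) := by
  refine IsSeqClosed.isClosed fun x y hx hxy => ?_
  choose p q h1 h2 using fun n => oscillatorGraph_iff.1 (hx n)
  have hbound : ∀ n m, ‖p n - p m‖ ^ 2 + c.re * ‖q n - q m‖ ^ 2 ≤ ‖x n - x m‖ ^ 2 := by
    intro n m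
    have hmem := formGraph.sub_mem (h1 n) (h1 m)
    have e1 := h2 n _ _ _ hmem
    have e2 := h2 m _ _ _ hmem
    have e3 : inner ℂ (p n - p m) (p n - p m) + c * inner ℂ (q n - q m) (q n - q m) =
        inner ℂ ((x n).1 - (x m).1) ((x n).2 - (x m).2) := by
      rw [inner_sub_right _ (p n), inner_sub_right _ (q n), inner_sub_right _ (x n).2]
      linear_combination e1 - e2
    have e4 := congrArg Complex.re e3
    rw [inner_self_eq_norm_sq_to_K, inner_self_eq_norm_sq_to_K] at e4
    simp only [Complex.coe_algebraMap, ← Complex.ofReal_pow, Complex.add_re, Complex.ofReal_re,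
      Complex.re_mul_ofReal] at e4
    rw [e4]
    refine (Complex.re_le_norm _).trans ((norm_inner_le_norm _ _).trans ?_)
    rw [sq]
    exact mul_le_mul (norm_fst_le (x n - x m)) (norm_snd_le (x n - x m)) (norm_nonneg _)
      (norm_nonneg _)
  have hcau : ∀ (r : ℕ → L2) (K : ℝ), 0 < K →
      (∀ n m, K * ‖r n - r m‖ ^ 2 ≤ ‖x n - x m‖ ^ 2) → CauchySeq r := by
    intro r K hK h
    rw [Metric.cauchySeq_iff]
    intro ε hε
    obtain ⟨N, hN⟩ := Metric.cauchySeq_iff.1 hxy.cauchySeq (√K * ε) (by positivity)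
    refine ⟨N, fun m hm n hn => ?_⟩
    have h3 := hN m hm n hn
    rw [dist_eq_norm] at h3 ⊢
    have h4 : K * ‖r m - r n‖ ^ 2 < K * ε ^ 2 := by
      refine (h m n).trans_lt ?_
      calc ‖x m - x n‖ ^ 2 < (√K * ε) ^ 2 := by gcongr
        _ = K * ε ^ 2 := by rw [mul_pow, Real.sq_sqrt hK.le]
    exact lt_of_pow_lt_pow_left₀ 2 hε.le (lt_of_mul_lt_mul_left h4 hK.le)
  obtain ⟨P, hP⟩ := cauchySeq_tendsto_of_complete (hcau p 1 one_pos fun n m => by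
    nlinarith [hbound n m, mul_nonneg hc.le (sq_nonneg ‖q n - q m‖)])
  obtain ⟨Q, hQ⟩ := cauchySeq_tendsto_of_complete (hcau q c.re hc fun n m => by
    nlinarith [hbound n m, sq_nonneg ‖p n - p m‖])
  have hx1 : Tendsto (fun n => (x n).1) atTop (𝓝 y.1) := (continuous_fst.tendsto y).comp hxy
  have hx2 : Tendsto (fun n => (x n).2) atTop (𝓝 y.2) := (continuous_snd.tendsto y).comp hxy
  refine oscillatorGraph_iff.2 ⟨P, Q, isClosed_formGraph.mem_of_tendsto
    (hx1.prodMk_nhds (hP.prodMk_nhds hQ)) (Eventually.of_forall h1), fun v r s hv => ?_⟩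
  exact tendsto_nhds_unique
    ((tendsto_const_nhds.inner hP).add ((tendsto_const_nhds.inner hQ).const_mul c))
    ((tendsto_const_nhds.inner hx2).congr fun n => (h2 n v r s hv).symm)

/-- The graph of `-τ H_c`. -/
noncomputable def generatorSubmodule (c τ : ℂ) : Submodule ℂ (L2 × L2) :=
  (oscillatorSubmodule c).map (LinearMap.prodMap LinearMap.id ((-τ) • LinearMap.id))

theorem mem_generatorSubmodule {c τ : ℂ} {f g : L2} :
    (f, g) ∈ generatorSubmodule c τ ↔ ∃ h, OscillatorGraph c f h ∧ g = (-τ) • h := by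
  simp only [generatorSubmodule, Submodule.mem_map, Prod.exists, mem_oscillatorSubmodule,
    LinearMap.prodMap_apply, Prod.mk.injEq, LinearMap.id_apply, LinearMap.smul_apply]
  constructor
  · rintro ⟨f', h, h1, rfl, rfl⟩; exact ⟨h, h1, rfl⟩
  · rintro ⟨h, h1, rfl⟩; exact ⟨f, h, h1, rfl, rfl⟩

theorem isClosed_generatorSubmodule {c τ : ℂ} (hc : 0 < c.re) (hτ : τ ≠ 0) :
    IsClosed (generatorSubmodule c τ : Set (L2 × L2)) := by
  have : (generatorSubmodule c τ : Set (L2 × L2)) =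
      (fun p : L2 × L2 => (p.1, (-τ)⁻¹ • p.2)) ⁻¹' (oscillatorSubmodule c) := by
    ext ⟨f, g⟩
    rw [SetLike.mem_coe, mem_generatorSubmodule]
    constructor
    · rintro ⟨h, h1, rfl⟩
      simpa [mem_oscillatorSubmodule, smul_smul, hτ] using h1
    · intro h
      exact ⟨_, h, by rw [smul_inv_smul₀ (neg_ne_zero.2 hτ)]⟩
  rw [this]
  exact (isClosed_oscillatorSubmodule hc).preimage (by fun_prop)

theorem generatorSubmodule_dissipative {c τ : ℂ} (h1 : 0 ≤ τ.re) (h2 : 0 ≤ (c * τ).re) :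
    ∀ p ∈ generatorSubmodule c τ, (inner ℂ p.1 p.2).re ≤ 0 := by
  rintro ⟨f, g⟩ hp
  obtain ⟨h, hh, rfl⟩ := mem_generatorSubmodule.1 hp
  obtain ⟨p, q, h3, h4⟩ := oscillatorGraph_iff.1 hh
  have e := h4 f p q h3
  rw [inner_self_eq_norm_sq_to_K, inner_self_eq_norm_sq_to_K] at e
  simp only [Complex.coe_algebraMap, ← Complex.ofReal_pow] at e
  simp only [inner_smul_right, ← e]
  have e2 : -τ * (((‖p‖ ^ 2 : ℝ) : ℂ) + c * ((‖q‖ ^ 2 : ℝ) : ℂ)) =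
      -(τ * ((‖p‖ ^ 2 : ℝ) : ℂ) + (c * τ) * ((‖q‖ ^ 2 : ℝ) : ℂ)) := by ring
  rw [e2, Complex.neg_re, Complex.add_re, Complex.re_mul_ofReal, Complex.re_mul_ofReal]
  have := mul_nonneg h1 (sq_nonneg ‖p‖)
  have := mul_nonneg h2 (sq_nonneg ‖q‖)
  linarith

/-- A weak derivative may be tested against smooth functions that are square integrable together
with their derivative. -/
theorem HasWeakDeriv.integral_mul_deriv {v w : L2} (h : HasWeakDeriv v w) {φ : ℝ → ℂ}
    (hφ : ContDiff ℝ ∞ φ) (h0 : MemLp φ 2 volume) (h1 : MemLp (deriv φ) 2 volume) :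
    ∫ x, v x * deriv φ x = -∫ x, w x * φ x := by
  -- Cut off with χ(x/(n+1)); the extra term in the derivative carries the factor 1/(n+1), and
  -- dominated convergence applies.
  let b : ContDiffBump (0 : ℝ) := ⟨1, 2, one_pos, one_lt_two⟩
  let χ : ℝ → ℂ := fun x => (b x : ℂ)
  have hχ : ContDiff ℝ ∞ χ := Complex.ofRealCLM.contDiff.comp b.contDiff
  have hχs : HasCompactSupport χ := b.hasCompactSupport.comp_left Complex.ofReal_zero
  have hχ1 : ∀ x, ‖χ x‖ ≤ 1 := fun x => by
    simp only [χ, Complex.norm_real, Real.norm_of_nonneg b.nonneg]; exact b.le_one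
  have hχd : ∀ x, HasDerivAt χ (deriv χ x) x := fun x =>
    (hχ.differentiable (by simp) x).hasDerivAt
  have hφd : ∀ x, HasDerivAt φ (deriv φ x) x := fun x =>
    (hφ.differentiable (by simp) x).hasDerivAt
  obtain ⟨M, hM⟩ := hχs.deriv.exists_bound_of_continuous (hχ.continuous_deriv (by simp))
  have hM0 : 0 ≤ M := (norm_nonneg _).trans (hM 0)
  let a : ℕ → ℝ := fun n => 1 / ((n : ℝ) + 1)
  have ha : ∀ n, 0 < a n := fun n => by positivity
  have ha1 : ∀ n, a n ≤ 1 := fun n => by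
    simp only [a]; rw [div_le_one (by positivity)]; linarith [(Nat.cast_nonneg n : (0 : ℝ) ≤ n)]
  have halim : Tendsto a atTop (𝓝 0) := tendsto_one_div_add_atTop_nhds_zero_nat
  have hχlim : ∀ x, Tendsto (fun n => χ (a n * x)) atTop (𝓝 1) := by
    intro x
    have h2 : Tendsto (fun n => χ (a n * x)) atTop (𝓝 (χ (0 * x))) :=
      (hχ.continuous.tendsto _).comp (halim.mul_const x)
    have h3 : χ (0 * x) = 1 := by
      simp only [χ, zero_mul]
      rw [b.one_of_mem_closedBall (Metric.mem_closedBall_self b.rIn_pos.le), Complex.ofReal_one]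
    rwa [h3] at h2
  have hd : ∀ n x, HasDerivAt (fun x => χ (a n * x) * φ x)
      (χ (a n * x) * deriv φ x + a n * deriv χ (a n * x) * φ x) x := by
    intro n x
    have h2 : HasDerivAt (fun x : ℝ => a n * x) (a n) x := by
      simpa using (hasDerivAt_id x).const_mul (a n)
    have h3 := ((hχd (a n * x)).scomp x h2).mul (hφd x)
    convert! h3 using 1
    simp; ring
  have hL : ∀ n, ∫ x, v x * (χ (a n * x) * deriv φ x + a n * deriv χ (a n * x) * φ x) =
      -∫ x, w x * (χ (a n * x) * φ x) := by
    intro n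
    have := h (fun x => χ (a n * x) * φ x)
      ((hχ.comp (contDiff_const.mul contDiff_id)).mul hφ)
      ((hχs.comp_smul (ha n).ne').mul_right)
    simpa only [(hd n _).deriv] using this
  have hcd : Continuous (deriv χ) := hχ.continuous_deriv (by simp)
  have hcφ : Continuous (deriv φ) := hφ.continuous_deriv (by simp)
  have hlim1 : Tendsto (fun n => ∫ x, v x *
      (χ (a n * x) * deriv φ x + a n * deriv χ (a n * x) * φ x)) atTop
      (𝓝 (∫ x, v x * deriv φ x)) := by
    refine tendsto_integral_of_dominated_convergence
      (fun x => ‖v x * deriv φ x‖ + M * ‖v x * φ x‖) (fun n => ?_) ?_ (fun n => ?_) ?_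
    · refine (Lp.aestronglyMeasurable v).mul (Continuous.aestronglyMeasurable ?_)
      have := hχ.continuous
      have := hφ.continuous
      fun_prop
    · exact (integrable_mul_of_memLp v h1).norm.add
        ((integrable_mul_of_memLp v h0).norm.const_mul M)
    · refine Eventually.of_forall fun x => ?_
      rw [mul_add]
      refine (norm_add_le _ _).trans (add_le_add ?_ ?_)
      · rw [mul_left_comm, norm_mul]
        exact mul_le_of_le_one_left (norm_nonneg _) (hχ1 _)
      · rw [mul_left_comm, norm_mul, norm_mul (a n : ℂ), Complex.norm_real,
          Real.norm_of_nonneg (ha n).le]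
        gcongr
        exact (mul_le_of_le_one_left (norm_nonneg _) (ha1 n)).trans (hM _)
    · refine Eventually.of_forall fun x => ?_
      have h4 : Tendsto (fun n => (a n : ℂ) * deriv χ (a n * x)) atTop (𝓝 0) := by
        have : Tendsto (fun n => (a n : ℂ) * deriv χ (a n * x)) atTop
            (𝓝 (((0 : ℝ) : ℂ) * deriv χ (0 * x))) :=
          ((Complex.continuous_ofReal.tendsto _).comp halim).mul
            ((hcd.tendsto _).comp (halim.mul_const x))
        simpa using this
      have := (((hχlim x).mul_const (deriv φ x)).add (h4.mul_const (φ x))).const_mul (v x)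
      simpa using this
  have hlim2 : Tendsto (fun n => -∫ x, w x * (χ (a n * x) * φ x)) atTop
      (𝓝 (-∫ x, w x * φ x)) := by
    refine Tendsto.neg ?_
    refine tendsto_integral_of_dominated_convergence (fun x => ‖w x * φ x‖) (fun n => ?_)
      (integrable_mul_of_memLp w h0).norm (fun n => ?_) ?_
    · refine (Lp.aestronglyMeasurable w).mul (Continuous.aestronglyMeasurable ?_)
      have := hχ.continuous
      have := hφ.continuous
      fun_prop
    · refine Eventually.of_forall fun x => ?_
      rw [mul_left_comm, norm_mul]
      exact mul_le_of_le_one_left (norm_nonneg _) (hχ1 _)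
    · refine Eventually.of_forall fun x => ?_
      have := ((hχlim x).mul_const (φ x)).const_mul (w x)
      simpa using this
  exact tendsto_nhds_unique hlim1 (hlim2.congr fun n => (hL n).symm)

/-- A classical derivative in `L²` is a weak derivative. -/
theorem hasWeakDeriv_of_hasDerivAt {f g : L2} {F F' : ℝ → ℂ} (hd : ∀ x, HasDerivAt F (F' x) x)
    (hf : f =ᵐ[volume] F) (hg : g =ᵐ[volume] F') : HasWeakDeriv f g := by
  intro φ h1 h2
  have hF : MemLp F 2 volume := (Lp.memLp f).ae_eq hf
  have hF' : MemLp F' 2 volume := (Lp.memLp g).ae_eq hg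
  have e1 : ∫ x, f x * deriv φ x = ∫ x, F x * deriv φ x := by
    refine integral_congr_ae ?_
    filter_upwards [hf] with x hx using by rw [hx]
  have e2 : ∫ x, g x * φ x = ∫ x, F' x * φ x := by
    refine integral_congr_ae ?_
    filter_upwards [hg] with x hx using by rw [hx]
  rw [e1, e2]
  exact integral_mul_deriv_eq_deriv_mul_of_integrable (fun x _ => hd x)
    (fun x _ => (h1.differentiable (by simp) x).hasDerivAt)
    (hF.integrable_mul (memLp_deriv_testFunction h1 h2))
    (hF'.integrable_mul (memLp_testFunction h1 h2)) (hF.integrable_mul (memLp_testFunction h1 h2))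

end WeakDerivatives

/-! ### Gaussians in `L²`: parameter derivatives, action of `H_c`, density. -/

section Gaussians

theorem memLp_exp_neg_mul_sq {δ : ℝ} (hδ : 0 < δ) :
    MemLp (fun x : ℝ => Real.exp (-δ * x ^ 2)) 2 volume := by
  refine (memLp_two_iff_integrable_sq_norm (by fun_prop)).2 ?_
  have := integrable_exp_neg_mul_sq (b := 2 * δ) (by positivity)
  refine this.congr (Eventually.of_forall fun x => ?_)
  simp only [Real.norm_eq_abs, Real.abs_exp, ← Real.exp_nat_mul]
  congr 1; push_cast; ring

theorem memLp_pow_mul_exp {δ : ℝ} (hδ : 0 < δ) (k : ℕ) (r : ℝ) :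
    MemLp (fun x : ℝ => |x| ^ k * Real.exp (r * |x| - δ * x ^ 2)) 2 volume := by
  -- The constant comes from |x|^k ≤ k! e^{|x|} and from completing the square, giving up half of δ.
  refine ((memLp_exp_neg_mul_sq (half_pos hδ)).const_mul
    (k.factorial * Real.exp ((r + 1) ^ 2 / (2 * δ)))).of_le (by fun_prop)
    (Eventually.of_forall fun x => ?_)
  rw [Real.norm_of_nonneg (by positivity), Real.norm_of_nonneg (by positivity)]
  have h1 : |x| ^ k ≤ k.factorial * Real.exp |x| := by
    have := Real.pow_div_factorial_le_exp |x| (abs_nonneg x) k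
    rwa [div_le_iff₀ (by positivity), mul_comm] at this
  calc |x| ^ k * Real.exp (r * |x| - δ * x ^ 2)
      ≤ k.factorial * Real.exp |x| * Real.exp (r * |x| - δ * x ^ 2) := by gcongr
    _ = k.factorial * Real.exp ((r + 1) * |x| - δ * x ^ 2) := by
        rw [mul_assoc, ← Real.exp_add]; congr 2; ring
    _ ≤ k.factorial * Real.exp ((r + 1) ^ 2 / (2 * δ) + -(δ / 2) * x ^ 2) := by
        gcongr
        have h2 : 0 ≤ (δ * |x| - (r + 1)) ^ 2 / (2 * δ) := by positivity
        have h3 : (δ * |x| - (r + 1)) ^ 2 / (2 * δ) =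
            δ / 2 * x ^ 2 - (r + 1) * |x| + (r + 1) ^ 2 / (2 * δ) := by
          rw [← sq_abs x]; field_simp; ring
        linarith
    _ = _ := by rw [Real.exp_add, mul_assoc]

/-- The function `x^k exp(-s x²/2 + b x)`. -/
noncomputable def gaussFun (s : ℂ) (k : ℕ) (b : ℂ) (x : ℝ) : ℂ :=
  (x : ℂ) ^ k * Complex.exp (-(s / 2) * (x : ℂ) ^ 2 + b * x)

theorem contDiff_gaussFun (s : ℂ) (k : ℕ) (b : ℂ) : ContDiff ℝ ∞ (gaussFun s k b) := by
  have h : ContDiff ℝ ∞ (fun x : ℝ => (x : ℂ)) := Complex.ofRealCLM.contDiff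
  exact (h.pow k).mul ((contDiff_const.mul (h.pow 2)).add (contDiff_const.mul h)).cexp

theorem norm_gaussFun_le (s : ℂ) (k : ℕ) (b : ℂ) (x : ℝ) :
    ‖gaussFun s k b x‖ ≤ |x| ^ k * Real.exp (‖b‖ * |x| - s.re / 2 * x ^ 2) := by
  rw [gaussFun, norm_mul, norm_pow, Complex.norm_real, Real.norm_eq_abs, Complex.norm_exp]
  gcongr
  have h1 : (-(s / 2) * (x : ℂ) ^ 2 + b * x).re = -(s.re / 2) * x ^ 2 + b.re * x := by
    rw [← Complex.ofReal_pow, Complex.add_re, Complex.re_mul_ofReal, Complex.re_mul_ofReal]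
    simp
  rw [h1]
  have h2 : b.re * x ≤ ‖b‖ * |x| := (le_abs_self _).trans (by
    rw [abs_mul]; gcongr; exact Complex.abs_re_le_norm b)
  linarith

variable {s : ℂ} (hs : 0 < s.re)

theorem memLp_gaussFun {s : ℂ} (hs : 0 < s.re) (k : ℕ) (b : ℂ) : MemLp (gaussFun s k b) 2 volume :=
  (memLp_pow_mul_exp (half_pos hs) k ‖b‖).of_le
    (contDiff_gaussFun s k b).continuous.aestronglyMeasurable
    (Eventually.of_forall fun x => (norm_gaussFun_le s k b x).trans (le_abs_self _))

/-- The class of `x^k exp(-s x²/2 + b x)` in `L²`. -/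
noncomputable def gauss (k : ℕ) (b : ℂ) : L2 := (memLp_gaussFun hs k b).toLp _

theorem coeFn_gauss (k : ℕ) (b : ℂ) : gauss hs k b =ᵐ[volume] gaussFun s k b :=
  (memLp_gaussFun hs k b).coeFn_toLp

theorem norm_gaussFun_sub_le (k : ℕ) (b z : ℂ) (hz : ‖z‖ ≤ 1) (x : ℝ) :
    ‖gaussFun s k (b + z) x - gaussFun s k b x - z * gaussFun s (k + 1) b x‖ ≤
      ‖z‖ ^ 2 * ‖|x| ^ (k + 2) * Real.exp ((‖b‖ + 1) * |x| - s.re / 2 * x ^ 2)‖ := by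
  have h1 : gaussFun s k (b + z) x - gaussFun s k b x - z * gaussFun s (k + 1) b x =
      gaussFun s k b x * (Complex.exp (z * x) - 1 - z * x) := by
    have : Complex.exp (-(s / 2) * (x : ℂ) ^ 2 + (b + z) * x) =
        Complex.exp (-(s / 2) * (x : ℂ) ^ 2 + b * x) * Complex.exp (z * x) := by
      rw [← Complex.exp_add]; ring_nf
    simp only [gaussFun, this]; ring
  have h2 : ‖Complex.exp (z * x) - 1 - z * x‖ ≤ ‖z * x‖ ^ 2 * Real.exp ‖z * x‖ := by
    have := Complex.norm_exp_sub_sum_le_norm_mul_exp (z * x) 2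
    simpa [Finset.sum_range_succ, sub_sub] using this
  have h3 : ‖z * (x : ℂ)‖ = ‖z‖ * |x| := by rw [norm_mul, Complex.norm_real, Real.norm_eq_abs]
  rw [h3] at h2
  rw [h1, norm_mul, Real.norm_of_nonneg (by positivity)]
  calc _ ≤ (|x| ^ k * Real.exp (‖b‖ * |x| - s.re / 2 * x ^ 2)) *
        ((‖z‖ * |x|) ^ 2 * Real.exp (1 * |x|)) := by
          refine mul_le_mul (norm_gaussFun_le s k b x) (h2.trans ?_) (norm_nonneg _) (by positivity)
          gcongr
    _ = ‖z‖ ^ 2 * (|x| ^ (k + 2) *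
        (Real.exp (‖b‖ * |x| - s.re / 2 * x ^ 2) * Real.exp (1 * |x|))) := by ring
    _ = _ := by rw [← Real.exp_add]; congr 3; ring

/-- Differentiating in b multiplies by x. The pointwise Taylor remainder is ‖z‖² times a fixed `L²`
function, hence o(z) in norm. -/
theorem hasDerivAt_gauss (k : ℕ) (b : ℂ) :
    HasDerivAt (gauss hs k) (gauss hs (k + 1) b) b := by
  rw [hasDerivAt_iff_isLittleO_nhds_zero]
  have hm := memLp_pow_mul_exp (half_pos hs) (k + 2) (‖b‖ + 1)
  refine (Asymptotics.IsBigO.of_bound ‖hm.toLp _‖ ?_).trans_isLittleO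
    (Asymptotics.isLittleO_pow_id one_lt_two)
  filter_upwards [Metric.ball_mem_nhds (0 : ℂ) zero_lt_one] with z hz
  have hz' : ‖z‖ ≤ 1 := by simpa using (Metric.mem_ball.1 hz).le
  rw [norm_pow, mul_comm]
  refine Lp.norm_le_mul_norm_of_ae_le_mul ?_
  filter_upwards [coeFn_gauss hs k (b + z), coeFn_gauss hs k b, coeFn_gauss hs (k + 1) b,
    hm.coeFn_toLp, Lp.coeFn_sub (gauss hs k (b + z) - gauss hs k b) (z • gauss hs (k + 1) b),
    Lp.coeFn_sub (gauss hs k (b + z)) (gauss hs k b), Lp.coeFn_smul z (gauss hs (k + 1) b)]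
    with x h1 h2 h3 h4 h5 h6 h7
  rw [h5, Pi.sub_apply, h6, Pi.sub_apply, h7, Pi.smul_apply, h1, h2, h3, h4, smul_eq_mul]
  exact norm_gaussFun_sub_le k b z hz' x

theorem hasDerivAt_gaussFun_zero (b : ℂ) (x : ℝ) :
    HasDerivAt (gaussFun s 0 b) (b * gaussFun s 0 b x - s * gaussFun s 1 b x) x := by
  have h1 : HasDerivAt (fun x : ℝ => (x : ℂ)) 1 x := Complex.ofRealCLM.hasDerivAt
  have h2 := (((h1.pow 2).const_mul (-(s / 2))).add (h1.const_mul b)).cexp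
  have h3 := (hasDerivAt_const x (1 : ℂ)).mul h2
  convert! h3 using 1
  simp [gaussFun]; ring

theorem hasDerivAt_gaussFun_one (b : ℂ) (x : ℝ) :
    HasDerivAt (gaussFun s 1 b)
      (gaussFun s 0 b x + b * gaussFun s 1 b x - s * gaussFun s 2 b x) x := by
  have h1 : HasDerivAt (fun x : ℝ => (x : ℂ)) 1 x := Complex.ofRealCLM.hasDerivAt
  have h3 := h1.mul (hasDerivAt_gaussFun_zero (s := s) b x)
  convert! h3 using 1
  · ext y; simp [gaussFun]
  · simp [gaussFun]; ring

/-- Integration by parts of a weak derivative against a smooth square integrable function with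
square integrable derivative. -/
theorem HasWeakDeriv.inner_eq {v r : L2} (h : HasWeakDeriv v r) {p p' : L2} {P : ℝ → ℂ}
    (hP : ContDiff ℝ ∞ P) (h0 : p =ᵐ[volume] P) (h1 : p' =ᵐ[volume] deriv P) :
    inner ℂ r p = -inner ℂ v p' := by
  have hd : ∀ x, deriv (fun x => conj (P x)) x = conj (deriv P x) := fun x =>
    ((hP.differentiable (by simp) x).hasDerivAt.star).deriv
  have hint : ∀ (u q : L2) (Q : ℝ → ℂ), q =ᵐ[volume] Q →
      inner ℂ q u = ∫ x, u x * conj (Q x) := by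
    intro u q Q hq
    rw [L2.inner_def]
    refine integral_congr_ae ?_
    filter_upwards [hq] with x hx
    simp [hx]
  have hP0 : MemLp P 2 volume := (Lp.memLp p).ae_eq h0
  have hP1 : MemLp (deriv P) 2 volume := (Lp.memLp p').ae_eq h1
  have key := h.integral_mul_deriv (φ := fun x => conj (P x))
    (Complex.conjCLE.contDiff.comp hP) hP0.star (by
      rw [show deriv (fun x => conj (P x)) = fun x => conj (deriv P x) from funext hd]
      exact hP1.star)
  simp only [hd] at key
  rw [← hint v p' _ h1, ← hint r p _ h0] at key
  rw [← inner_conj_symm r p, ← inner_conj_symm v p', key, map_neg, neg_neg]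

theorem gauss_mem_formGraph (b : ℂ) :
    (gauss hs 0 b, b • gauss hs 0 b - s • gauss hs 1 b, gauss hs 1 b) ∈ formGraph := by
  refine mem_formGraph.2 ⟨hasWeakDeriv_of_hasDerivAt (hasDerivAt_gaussFun_zero b)
    (coeFn_gauss hs 0 b) ?_, ?_⟩
  · filter_upwards [coeFn_gauss hs 0 b, coeFn_gauss hs 1 b,
      Lp.coeFn_sub (b • gauss hs 0 b) (s • gauss hs 1 b), Lp.coeFn_smul b (gauss hs 0 b),
      Lp.coeFn_smul s (gauss hs 1 b)] with x h1 h2 h3 h4 h5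
    rw [h3, Pi.sub_apply, h4, h5, Pi.smul_apply, Pi.smul_apply, h1, h2, smul_eq_mul, smul_eq_mul]
  · filter_upwards [coeFn_gauss hs 0 b, coeFn_gauss hs 1 b] with x h1 h2
    rw [h1, h2]; simp [gaussFun]

/-- Integrating by parts once more produces -s²x² from -d²/dx², which cancels against cx². -/
theorem oscillatorGraph_gauss {c : ℂ} (hsc : s ^ 2 = c) (b : ℂ) :
    OscillatorGraph c (gauss hs 0 b)
      ((s - b ^ 2) • gauss hs 0 b + (2 * s * b) • gauss hs 1 b) := by
  refine oscillatorGraph_iff.2 ⟨_, _, gauss_mem_formGraph hs b, fun v r t hv => ?_⟩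
  obtain ⟨hw, ht⟩ := mem_formGraph.1 hv
  have h0 : inner ℂ r (gauss hs 0 b) = -inner ℂ v (b • gauss hs 0 b - s • gauss hs 1 b) := by
    refine hw.inner_eq (contDiff_gaussFun s 0 b) (coeFn_gauss hs 0 b) ?_
    filter_upwards [coeFn_gauss hs 0 b, coeFn_gauss hs 1 b,
      Lp.coeFn_sub (b • gauss hs 0 b) (s • gauss hs 1 b), Lp.coeFn_smul b (gauss hs 0 b),
      Lp.coeFn_smul s (gauss hs 1 b)] with x h1 h2 h3 h4 h5
    rw [h3, Pi.sub_apply, h4, h5, Pi.smul_apply, Pi.smul_apply, h1, h2, smul_eq_mul, smul_eq_mul,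
      (hasDerivAt_gaussFun_zero b x).deriv]
  have h1 : inner ℂ r (gauss hs 1 b) =
      -inner ℂ v (gauss hs 0 b + b • gauss hs 1 b - s • gauss hs 2 b) := by
    refine hw.inner_eq (contDiff_gaussFun s 1 b) (coeFn_gauss hs 1 b) ?_
    filter_upwards [coeFn_gauss hs 0 b, coeFn_gauss hs 1 b, coeFn_gauss hs 2 b,
      Lp.coeFn_sub (gauss hs 0 b + b • gauss hs 1 b) (s • gauss hs 2 b),
      Lp.coeFn_add (gauss hs 0 b) (b • gauss hs 1 b), Lp.coeFn_smul b (gauss hs 1 b),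
      Lp.coeFn_smul s (gauss hs 2 b)] with x h1 h2 h3 h4 h5 h6 h7
    rw [h4, Pi.sub_apply, h5, Pi.add_apply, h6, h7, Pi.smul_apply, Pi.smul_apply, h1, h2, h3,
      smul_eq_mul, smul_eq_mul, (hasDerivAt_gaussFun_one b x).deriv]
  have h2 : inner ℂ t (gauss hs 1 b) = inner ℂ v (gauss hs 2 b) := by
    rw [L2.inner_def, L2.inner_def]
    refine integral_congr_ae ?_
    filter_upwards [ht, coeFn_gauss hs 1 b, coeFn_gauss hs 2 b] with x hx hx1 hx2
    simp [hx, hx1, hx2, gaussFun]; ring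
  simp only [inner_sub_right, inner_add_right, inner_smul_right] at h0 h1 ⊢
  rw [h2, h0, h1]
  linear_combination (-inner ℂ v (gauss hs 2 b)) * hsc

-- Purely imaginary b suffice: orthogonality to those Gaussians says that f times a nowhere
-- vanishing Gaussian is an integrable function with zero Fourier transform.
open scoped FourierTransform in
theorem dense_span_gauss :
    Dense (Submodule.span ℂ (Set.range (gauss hs 0)) : Set L2) := by
  rw [Submodule.dense_iff_topologicalClosure_eq_top, Submodule.topologicalClosure_eq_top_iff,
    Submodule.eq_bot_iff]
  intro f hf
  have horth : ∀ b, inner ℂ (gauss hs 0 b) f = 0 := fun b =>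
    Submodule.inner_right_of_mem_orthogonal (Submodule.subset_span (Set.mem_range_self b)) hf
  set h : ℝ → ℂ := fun x => f x * conj (gaussFun s 0 0 x) with hh
  have hint : Integrable h := integrable_mul_of_memLp f (memLp_gaussFun hs 0 0).star
  have hF : ∀ w : ℝ, 𝓕 h w = 0 := by
    intro w
    rw [Real.fourier_real_eq_integral_exp_smul, ← horth ((2 * Real.pi * w : ℝ) * Complex.I),
      L2.inner_def]
    refine integral_congr_ae ?_
    filter_upwards [coeFn_gauss hs 0 ((2 * Real.pi * w : ℝ) * Complex.I)] with x hx
    rw [hx, hh]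
    simp only [gaussFun, RCLike.inner_apply, smul_eq_mul, zero_mul, add_zero, pow_zero, one_mul,
      Complex.exp_add, map_mul]
    have : conj (Complex.exp ((2 * Real.pi * w : ℝ) * Complex.I * x)) =
        Complex.exp (((-2 * Real.pi * x * w : ℝ) : ℂ) * Complex.I) := by
      rw [← Complex.exp_conj]
      simp [map_ofNat]
      ring_nf
    rw [this]
    ring
  have h0 := ae_eq_zero_of_forall_testFunction hint.locallyIntegrable fun φ h1 h2 => by
    let ψ : SchwartzMap ℝ ℂ := h2.toSchwartzMap h1
    -- Writing the test function as a Fourier transform moves the transform onto h, where it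
    -- vanishes.
    have h3 : 𝓕 ((𝓕⁻ ψ : SchwartzMap ℝ ℂ) : ℝ → ℂ) = φ := by
      rw [← SchwartzMap.fourier_coe, FourierTransform.fourier_fourierInv_eq]; rfl
    have h4 : ∫ x, 𝓕 ((𝓕⁻ ψ : SchwartzMap ℝ ℂ) : ℝ → ℂ) x • h x =
        ∫ x, (𝓕⁻ ψ : SchwartzMap ℝ ℂ) x • 𝓕 h x := by
      simpa using! (VectorFourier.integral_fourierIntegral_smul_eq_flip (L := innerₗ ℝ)
        Real.continuous_fourierChar continuous_inner
        (SchwartzMap.integrable (𝓕⁻ ψ : SchwartzMap ℝ ℂ)) hint)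
    rw [h3] at h4
    simp only [hF, smul_zero, integral_zero] at h4
    simpa [mul_comm] using h4
  refine (Lp.eq_zero_iff_ae_eq_zero).2 ?_
  filter_upwards [h0] with x hx
  simpa [hh, gaussFun, Complex.exp_ne_zero] using hx

end Gaussians

/-! ### Estimates on the Mehler kernel and its action on Gaussians. -/

section Mehler

/-- The set of `τ` for which `τ`, `c τ` and `c^{1/2} τ` lie in the right half-plane, the latter
strictly. -/
def admissible (c : ℂ) : Set ℂ :=
  {τ | 0 ≤ τ.re ∧ 0 ≤ (c * τ).re ∧ 0 < (c ^ (1 / 2 : ℂ) * τ).re}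

theorem zero_notMem_admissible (c : ℂ) : (0 : ℂ) ∉ admissible c := by
  simp [admissible]

theorem add_mem_admissible {c σ τ : ℂ} (hσ : σ ∈ admissible c) (hτ : τ ∈ admissible c) :
    σ + τ ∈ admissible c := by
  obtain ⟨h1, h2, h3⟩ := hσ
  obtain ⟨h4, h5, h6⟩ := hτ
  refine ⟨?_, ?_, ?_⟩ <;> simp only [mul_add, Complex.add_re] <;> linarith

theorem smul_mem_admissible {c τ : ℂ} (hτ : τ ∈ admissible c) {t : ℝ} (ht : 0 < t) :
    (t : ℂ) * τ ∈ admissible c := by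
  obtain ⟨h1, h2, h3⟩ := hτ
  refine ⟨?_, ?_, ?_⟩
  · rw [Complex.re_ofReal_mul]; positivity
  · rw [mul_left_comm, Complex.re_ofReal_mul]; positivity
  · rw [mul_left_comm, Complex.re_ofReal_mul]; positivity

variable {c : ℂ}

theorem sqrt_sq (c : ℂ) : (c ^ (1 / 2 : ℂ)) ^ 2 = c := by
  rw [one_div]; exact Complex.cpow_ofNat_inv_pow c 2

theorem abs_arg_lt (hc : 0 < c.re) : |c.arg| < Real.pi / 2 :=
  Complex.abs_arg_lt_pi_div_two_iff.2 (Or.inl hc)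

theorem ne_zero_of_re_pos (hc : 0 < c.re) : c ≠ 0 := by
  rintro rfl; simp at hc

theorem log_sqrt (hc : 0 < c.re) : Complex.log (c ^ (1 / 2 : ℂ)) = Complex.log c / 2 := by
  have h := abs_lt.1 (abs_arg_lt hc)
  have h1 : (Complex.log c * (1 / 2 : ℂ)).im = c.arg / 2 := by
    have : (Complex.log c * (1 / 2 : ℂ)) = Complex.log c * ((1 / 2 : ℝ) : ℂ) := by push_cast; rfl
    rw [this, Complex.im_mul_ofReal, Complex.log_im]; ring
  rw [Complex.cpow_def_of_ne_zero (ne_zero_of_re_pos hc), Complex.log_exp]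
  · ring
  · rw [h1]; linarith [Real.pi_pos]
  · rw [h1]; linarith [Real.pi_pos]

theorem arg_sqrt (hc : 0 < c.re) : (c ^ (1 / 2 : ℂ)).arg = c.arg / 2 := by
  have h : Complex.log c / 2 = Complex.log c * ((1 / 2 : ℝ) : ℂ) := by push_cast; ring
  rw [← Complex.log_im, log_sqrt hc, h, Complex.im_mul_ofReal, Complex.log_im]; ring

theorem sqrt_re_pos (hc : 0 < c.re) : 0 < (c ^ (1 / 2 : ℂ)).re := by
  have h := abs_lt.1 (abs_arg_lt hc)
  have h1 : |(c ^ (1 / 2 : ℂ)).arg| < Real.pi / 2 := by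
    rw [arg_sqrt hc, abs_lt]; constructor <;> linarith [Real.pi_pos]
  refine (Complex.abs_arg_lt_pi_div_two_iff.1 h1).resolve_right ?_
  simp [Complex.cpow_eq_zero_iff, ne_zero_of_re_pos hc]

theorem lam_eq (c τ : ℂ) : lam c τ = Complex.exp (-2 * (c ^ (1 / 2 : ℂ) * τ)) := by
  rw [lam, mul_assoc]

theorem lam_add (c σ τ : ℂ) : lam c (σ + τ) = lam c σ * lam c τ := by
  simp only [lam, ← Complex.exp_add]; ring_nf

theorem norm_lam_lt_one {τ : ℂ} (hτ : τ ∈ admissible c) : ‖lam c τ‖ < 1 := by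
  rw [lam_eq, Complex.norm_exp, Real.exp_lt_one_iff]
  have := hτ.2.2
  simp only [Complex.mul_re, Complex.neg_re, Complex.re_ofNat, Complex.neg_im, Complex.im_ofNat]
    at this ⊢
  linarith

theorem re_mul_div_pos {s ℓ : ℂ} (hℓ : ‖ℓ‖ < 1) (h : |2 * s.im * ℓ.im| < s.re * (1 - ‖ℓ‖ ^ 2)) :
    0 < (s * (1 + ℓ) / (1 - ℓ)).re := by
  have h0 : 1 - ℓ ≠ 0 := by
    intro h
    rw [← sub_eq_zero.1 h] at hℓ
    simp at hℓ
  have h1 : s * (1 + ℓ) / (1 - ℓ) = s * (1 + ℓ) * conj (1 - ℓ) * ((Complex.normSq (1 - ℓ))⁻¹ : ℝ) := by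
    rw [div_eq_mul_inv, Complex.inv_def, mul_assoc _ (conj _)]
  rw [h1, Complex.re_mul_ofReal]
  refine mul_pos ?_ (inv_pos.2 (Complex.normSq_pos.2 h0))
  have h2 : (s * (1 + ℓ) * conj (1 - ℓ)).re = s.re * (1 - ‖ℓ‖ ^ 2) - 2 * s.im * ℓ.im := by
    rw [← Complex.normSq_eq_norm_sq, Complex.normSq_apply]
    simp
    ring
  rw [h2]
  linarith [(abs_lt.1 h).2]

/-- Put s = c^{1/2}, z = sτ. Then Re(cτ) = Re(sz) and |s|² Re τ = Re(s̄z), so the two closed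
conditions say |Im s Im z| ≤ Re s Re z. Strictness, even on the edges, comes from |sin 2 Im z| ≤
2|Im z| and 2 Re z < sinh(2 Re z). -/
theorem abs_im_lam_lt (hc : 0 < c.re) {τ : ℂ} (hτ : τ ∈ admissible c) :
    |2 * (c ^ (1 / 2 : ℂ)).im * (lam c τ).im| < (c ^ (1 / 2 : ℂ)).re * (1 - ‖lam c τ‖ ^ 2) := by
  have hp := sqrt_re_pos hc
  obtain ⟨h1, h2, h3⟩ := hτ
  rw [lam_eq]
  have hz : c * τ = c ^ (1 / 2 : ℂ) * (c ^ (1 / 2 : ℂ) * τ) := by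
    rw [← mul_assoc, ← sq, sqrt_sq]
  have hz' : ‖c ^ (1 / 2 : ℂ)‖ ^ 2 * τ.re =
      (conj (c ^ (1 / 2 : ℂ)) * (c ^ (1 / 2 : ℂ) * τ)).re := by
    rw [← mul_assoc, mul_comm (conj _), Complex.mul_conj, Complex.re_ofReal_mul,
      Complex.normSq_eq_norm_sq]
  have h4 : 0 ≤ (conj (c ^ (1 / 2 : ℂ)) * (c ^ (1 / 2 : ℂ) * τ)).re := by
    rw [← hz']; positivity
  rw [hz] at h2
  generalize c ^ (1 / 2 : ℂ) * τ = z at h2 h3 h4 ⊢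
  generalize c ^ (1 / 2 : ℂ) = s at h2 h4 hp ⊢
  simp only [Complex.mul_re, Complex.conj_re, Complex.conj_im] at h2 h4
  have hre : (-2 * z).re = -(2 * z.re) := by simp
  have him : (-2 * z).im = -(2 * z.im) := by simp
  rw [Complex.norm_exp, Complex.exp_im, hre, him, Real.sin_neg]
  have hbq : |s.im * z.im| ≤ s.re * z.re := abs_le.2 ⟨by linarith, by linarith⟩
  have hsin : |Real.sin (2 * z.im)| ≤ |2 * z.im| := Real.abs_sin_le_abs
  have hsinh := Real.self_lt_sinh_iff.2 (show 0 < 2 * z.re by linarith)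
  rw [Real.sinh_eq] at hsinh
  set E := Real.exp (-(2 * z.re)) with hE
  have hE0 : 0 < E := Real.exp_pos _
  have hEE : Real.exp (2 * z.re) * E = 1 := by rw [hE, ← Real.exp_add]; simp
  have h5 : 4 * z.re * E < 1 - E ^ 2 := by
    have := mul_lt_mul_of_pos_right hsinh hE0
    nlinarith
  calc |2 * s.im * (E * -Real.sin (2 * z.im))|
      = 2 * |s.im| * E * |Real.sin (2 * z.im)| := by
        simp only [abs_mul, abs_neg, abs_of_pos hE0, abs_two]; ring
    _ ≤ 2 * |s.im| * E * |2 * z.im| := by gcongr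
    _ = 4 * E * |s.im * z.im| := by simp only [abs_mul, abs_two]; ring
    _ ≤ 4 * E * (s.re * z.re) := by gcongr
    _ = s.re * (4 * z.re * E) := by ring
    _ < s.re * (1 - E ^ 2) := by gcongr

theorem one_sub_lam_sq_re_pos {τ : ℂ} (hτ : τ ∈ admissible c) : 0 < (1 - lam c τ ^ 2).re := by
  have h := norm_lam_lt_one hτ
  have h1 : (lam c τ ^ 2).re ≤ ‖lam c τ‖ ^ 2 := (Complex.re_le_norm _).trans_eq (norm_pow _ _)
  have h2 : ‖lam c τ‖ ^ 2 < 1 := by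
    rw [sq]; nlinarith [norm_nonneg (lam c τ)]
  rw [Complex.sub_re, Complex.one_re]
  linarith

theorem one_sub_lam_ne_zero {τ : ℂ} (hτ : τ ∈ admissible c) : 1 - lam c τ ≠ 0 := by
  intro h
  have := norm_lam_lt_one hτ
  rw [← sub_eq_zero.1 h] at this
  simp at this

theorem one_add_lam_ne_zero {τ : ℂ} (hτ : τ ∈ admissible c) : 1 + lam c τ ≠ 0 := by
  intro h
  have := norm_lam_lt_one hτ
  rw [← neg_eq_of_add_eq_zero_right h] at this
  simp at this

/-- Both 2w₂ ± w₃ = c^{1/2}(1 ± λ)/(1 ∓ λ) have positive real part; the second case is the first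
with -λ for λ. -/
theorem abs_w₃_re_lt (hc : 0 < c.re) {τ : ℂ} (hτ : τ ∈ admissible c) :
    |(w₃ c τ).re| < 2 * (w₂ c τ).re := by
  have h0 := one_sub_lam_ne_zero hτ
  have h1 := one_add_lam_ne_zero hτ
  have h2 : 1 - lam c τ ^ 2 ≠ 0 := by
    rw [show 1 - lam c τ ^ 2 = (1 - lam c τ) * (1 + lam c τ) by ring]
    exact mul_ne_zero h0 h1
  have e1 : 2 * w₂ c τ + w₃ c τ = c ^ (1 / 2 : ℂ) * (1 + lam c τ) / (1 - lam c τ) := by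
    rw [w₂, w₃]; field_simp; ring
  have e2 : 2 * w₂ c τ - w₃ c τ = c ^ (1 / 2 : ℂ) * (1 + -lam c τ) / (1 - -lam c τ) := by
    rw [w₂, w₃, sub_neg_eq_add]; field_simp; ring
  have p1 := re_mul_div_pos (norm_lam_lt_one hτ) (abs_im_lam_lt hc hτ)
  have p2 := re_mul_div_pos (s := c ^ (1 / 2 : ℂ)) (ℓ := -lam c τ)
    (by rw [norm_neg]; exact norm_lam_lt_one hτ)
    (by rw [norm_neg, Complex.neg_im, mul_neg, abs_neg]; exact abs_im_lam_lt hc hτ)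
  rw [← e1] at p1
  rw [← e2] at p2
  simp only [Complex.add_re, Complex.sub_re, Complex.mul_re, Complex.re_ofNat, Complex.im_ofNat,
    zero_mul, sub_zero] at p1 p2
  rw [abs_lt]
  constructor <;> linarith

theorem norm_kernel_le (c τ : ℂ) (x y : ℝ) :
    ‖kernel c τ x y‖ ≤ ‖w₁ c τ‖ *
      (Real.exp (-((w₂ c τ).re - |(w₃ c τ).re| / 2) * x ^ 2) *
        Real.exp (-((w₂ c τ).re - |(w₃ c τ).re| / 2) * y ^ 2)) := by
  rw [kernel, norm_mul, Complex.norm_exp, ← Real.exp_add]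
  gcongr
  have e : (w₃ c τ * x * y - w₂ c τ * ((x : ℂ) ^ 2 + (y : ℂ) ^ 2)).re =
      (w₃ c τ).re * (x * y) - (w₂ c τ).re * (x ^ 2 + y ^ 2) := by
    have : w₃ c τ * x * y - w₂ c τ * ((x : ℂ) ^ 2 + (y : ℂ) ^ 2) =
        w₃ c τ * ((x * y : ℝ) : ℂ) - w₂ c τ * ((x ^ 2 + y ^ 2 : ℝ) : ℂ) := by push_cast; ring
    rw [this, Complex.sub_re, Complex.re_mul_ofReal, Complex.re_mul_ofReal]
  rw [e]
  have h1 : (w₃ c τ).re * (x * y) ≤ |(w₃ c τ).re| * ((x ^ 2 + y ^ 2) / 2) := by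
    refine (le_abs_self _).trans ?_
    rw [abs_mul]
    gcongr
    rw [abs_le]
    constructor <;> nlinarith [sq_nonneg (x + y), sq_nonneg (x - y)]
  linarith

theorem exists_kernelOperator (hc : 0 < c.re) {τ : ℂ} (hτ : τ ∈ admissible c) :
    ∃ T : L2 →L[ℂ] L2, IsHilbertSchmidt T ∧ ∀ f : L2,
      (∀ x, Integrable (fun y => kernel c τ x y * f y)) ∧
      T f =ᵐ[volume] fun x => ∫ y, kernel c τ x y * f y := by
  have hδ : 0 < (w₂ c τ).re - |(w₃ c τ).re| / 2 := by linarith [abs_w₃_re_lt hc hτ]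
  refine exists_integralOperator ?_ ((memLp_exp_neg_mul_sq hδ).const_mul √‖w₁ c τ‖) fun x y => ?_
  · unfold kernel
    fun_prop
  · refine (norm_kernel_le c τ x y).trans_eq ?_
    nth_rw 1 [← Real.mul_self_sqrt (norm_nonneg (w₁ c τ))]
    ring

/-- X and c^{1/2} both lie in the right half-plane, so the principal logarithm of their quotient is
the difference of logarithms and the branches match. -/
theorem cpow_prefactor (hc : 0 < c.re) {X : ℂ} (hX : 0 < X.re) :
    c ^ (1 / 4 : ℂ) * X ^ (-(1 / 2) : ℂ) * (X / c ^ (1 / 2 : ℂ)) ^ (1 / 2 : ℂ) = 1 := by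
  have hs := sqrt_re_pos hc
  have hs0 := ne_zero_of_re_pos hs
  have hX0 := ne_zero_of_re_pos hX
  have h1 := abs_lt.1 (abs_arg_lt hX)
  have h2 := abs_lt.1 (abs_arg_lt hs)
  have h3 : (c ^ (1 / 2 : ℂ)).arg ≠ Real.pi := by linarith [Real.pi_pos]
  have hlog : Complex.log (X / c ^ (1 / 2 : ℂ)) = Complex.log X - Complex.log c / 2 := by
    rw [div_eq_mul_inv, Complex.log_mul hX0 (inv_ne_zero hs0), Complex.log_inv _ h3, log_sqrt hc]
    · ring
    · rw [Complex.arg_inv, if_neg h3]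
      constructor <;> linarith
  rw [Complex.cpow_def_of_ne_zero (ne_zero_of_re_pos hc), Complex.cpow_def_of_ne_zero hX0,
    Complex.cpow_def_of_ne_zero (div_ne_zero hX0 hs0), hlog, ← Complex.exp_add, ← Complex.exp_add,
    ← Complex.exp_zero]
  congr 1
  ring

/-- The scalar factor by which the evolution multiplies a Gaussian. -/
noncomputable def mehlerFactor (c τ b : ℂ) : ℂ :=
  Complex.exp (-(c ^ (1 / 2 : ℂ)) * τ + b ^ 2 * (1 - lam c τ ^ 2) / (4 * c ^ (1 / 2 : ℂ)))

/-- A Gaussian integral whose quadratic coefficient collapses: w₂ + c^{1/2}/2 = c^{1/2}/(1 - λ²).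
This is why the Gaussian width c^{1/2} is preserved. -/
theorem integral_kernel_mul_gaussFun (hc : 0 < c.re) {τ : ℂ} (hτ : τ ∈ admissible c) (b : ℂ)
    (x : ℝ) : ∫ y, kernel c τ x y * gaussFun (c ^ (1 / 2 : ℂ)) 0 b y =
      mehlerFactor c τ b * gaussFun (c ^ (1 / 2 : ℂ)) 0 (lam c τ * b) x := by
  have hX := one_sub_lam_sq_re_pos hτ
  have hX0 := ne_zero_of_re_pos hX
  have hs := sqrt_re_pos hc
  have hs0 := ne_zero_of_re_pos hs
  have hw : w₂ c τ + c ^ (1 / 2 : ℂ) / 2 = c ^ (1 / 2 : ℂ) / (1 - lam c τ ^ 2) := by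
    rw [w₂]; field_simp; ring
  have hpos : 0 < (w₂ c τ + c ^ (1 / 2 : ℂ) / 2).re := by
    have h1 := abs_w₃_re_lt hc hτ
    have h2 := abs_nonneg (w₃ c τ).re
    have h3 : (c ^ (1 / 2 : ℂ) / 2).re = (c ^ (1 / 2 : ℂ)).re / 2 := by simp
    rw [Complex.add_re, h3]
    linarith
  have hint := integral_cexp_quadratic (b := -(w₂ c τ + c ^ (1 / 2 : ℂ) / 2))
    (by rw [Complex.neg_re]; linarith) (w₃ c τ * x + b) (-(w₂ c τ) * (x : ℂ) ^ 2)
  have hfun : ∀ y : ℝ, kernel c τ x y * gaussFun (c ^ (1 / 2 : ℂ)) 0 b y = w₁ c τ *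
      Complex.exp (-(w₂ c τ + c ^ (1 / 2 : ℂ) / 2) * (y : ℂ) ^ 2 + (w₃ c τ * x + b) * y +
        -(w₂ c τ) * (x : ℂ) ^ 2) := by
    intro y
    rw [kernel, gaussFun, pow_zero, one_mul, mul_assoc, ← Complex.exp_add]
    congr 2
    ring
  simp only [hfun]
  rw [integral_const_mul, hint, neg_neg, hw]
  have hpre : w₁ c τ * ((Real.pi : ℂ) / (c ^ (1 / 2 : ℂ) / (1 - lam c τ ^ 2))) ^ (1 / 2 : ℂ) =
      Complex.exp (-(c ^ (1 / 2 : ℂ)) * τ) := by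
    have h1 : 0 < ((Real.pi : ℂ) * (1 - lam c τ ^ 2)).re := by
      rw [Complex.re_ofReal_mul]; have := Real.pi_pos; positivity
    have h2 := cpow_prefactor hc h1
    rw [w₁, div_div_eq_mul_div]
    linear_combination Complex.exp (-(c ^ (1 / 2 : ℂ)) * τ) * h2
  rw [← mul_assoc, hpre, mehlerFactor, gaussFun, pow_zero, one_mul, ← Complex.exp_add,
    ← Complex.exp_add]
  congr 1
  rw [w₂, w₃]
  field_simp
  ring

end Mehler

/-! ### The Mehler operators form a semigroup generated by `-τ H_c`. -/

section Semigroup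

variable {c : ℂ}

open Classical in
/-- The integral operator with kernel `K_c(τ, ·, ·)` for admissible `τ`, and the identity for other
`τ` (in particular for `τ = 0`). -/
noncomputable def mehlerOp (hc : 0 < c.re) (τ : ℂ) : L2 →L[ℂ] L2 :=
  if hτ : τ ∈ admissible c then (exists_kernelOperator hc hτ).choose else 1

variable (hc : 0 < c.re)

theorem mehlerOp_zero : mehlerOp hc 0 = 1 := dif_neg (zero_notMem_admissible c)

theorem mehlerOp_spec {τ : ℂ} (hτ : τ ∈ admissible c) :
    IsHilbertSchmidt (mehlerOp hc τ) ∧ ∀ f : L2,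
      (∀ x, Integrable (fun y => kernel c τ x y * f y)) ∧
      mehlerOp hc τ f =ᵐ[volume] fun x => ∫ y, kernel c τ x y * f y := by
  rw [mehlerOp, dif_pos hτ]
  exact (exists_kernelOperator hc hτ).choose_spec

theorem lam_zero (c : ℂ) : lam c 0 = 1 := by simp [lam]

theorem mehlerOp_gauss {τ : ℂ} (hτ : τ ∈ insert 0 (admissible c)) (b : ℂ) :
    mehlerOp hc τ (gauss (sqrt_re_pos hc) 0 b) =
      mehlerFactor c τ b • gauss (sqrt_re_pos hc) 0 (lam c τ * b) := by
  rcases hτ with rfl | hτ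
  · simp [mehlerOp_zero, mehlerFactor, lam_zero]
  refine Lp.ext ?_
  filter_upwards [((mehlerOp_spec hc hτ).2 (gauss (sqrt_re_pos hc) 0 b)).2,
    coeFn_gauss (sqrt_re_pos hc) 0 (lam c τ * b),
    Lp.coeFn_smul (mehlerFactor c τ b) (gauss (sqrt_re_pos hc) 0 (lam c τ * b))] with x h1 h2 h3
  rw [h1, h3, Pi.smul_apply, h2, smul_eq_mul, ← integral_kernel_mul_gaussFun hc hτ]
  refine integral_congr_ae ?_
  filter_upwards [coeFn_gauss (sqrt_re_pos hc) 0 b] with y hy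
  rw [hy]

theorem mehlerFactor_add (hc : 0 < c.re) (σ τ b : ℂ) :
    mehlerFactor c (σ + τ) b = mehlerFactor c τ b * mehlerFactor c σ (lam c τ * b) := by
  have hs0 := ne_zero_of_re_pos (sqrt_re_pos hc)
  simp only [mehlerFactor, ← Complex.exp_add, lam_add]
  congr 1
  field_simp
  ring

theorem mehlerOp_add {σ τ : ℂ} (hσ : σ ∈ admissible c) (hτ : τ ∈ admissible c) :
    mehlerOp hc (σ + τ) = mehlerOp hc σ ∘L mehlerOp hc τ := by
  refine ContinuousLinearMap.ext_on (dense_span_gauss (sqrt_re_pos hc)) ?_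
  rintro _ ⟨b, rfl⟩
  rw [ContinuousLinearMap.comp_apply, mehlerOp_gauss hc (Set.mem_insert_of_mem _ hτ), map_smul,
    mehlerOp_gauss hc (Set.mem_insert_of_mem _ hσ),
    mehlerOp_gauss hc (Set.mem_insert_of_mem _ (add_mem_admissible hσ hτ)), smul_smul, mehlerFactor_add hc,
    lam_add, mul_assoc]

/-- `F` is an entire solution of `F' = -H_c F` that agrees with `mehlerOp hc τ f` for admissible
`τ` and for `τ = 0`. -/
structure IsEntireOrbit (f : L2) (F F' : ℂ → L2) : Prop where
  hasDerivAt : ∀ z, HasDerivAt F (F' z) z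
  graph : ∀ z, OscillatorGraph c (F z) (-F' z)
  eq : ∀ τ ∈ insert 0 (admissible c), mehlerOp hc τ f = F τ

theorem IsEntireOrbit.apply_zero {f : L2} {F F' : ℂ → L2} (h : IsEntireOrbit hc f F F') :
    F 0 = f := by
  rw [← h.eq 0 (Set.mem_insert _ _), mehlerOp_zero]; rfl

theorem exists_isEntireOrbit_gauss (b : ℂ) :
    ∃ F F', IsEntireOrbit hc (gauss (sqrt_re_pos hc) 0 b) F F' := by
  have hs := sqrt_re_pos hc
  have hs0 := ne_zero_of_re_pos hs
  set s := c ^ (1 / 2 : ℂ) with hsdef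
  refine ⟨fun z => mehlerFactor c z b • gauss hs 0 (lam c z * b), fun z => mehlerFactor c z b •
    ((-s + lam c z ^ 2 * b ^ 2) • gauss hs 0 (lam c z * b) -
      (2 * s * (lam c z * b)) • gauss hs 1 (lam c z * b)), fun z => ?_, fun z => ?_,
    fun τ hτ => mehlerOp_gauss hc hτ b⟩
  · have h1 : HasDerivAt (lam c) (-2 * s * lam c z) z := by
      have := (((hasDerivAt_id z).const_mul (-2 * s))).cexp
      convert! this using 1
      simp [lam, hsdef]; ring
    have h2 : HasDerivAt (fun z => mehlerFactor c z b)
        (mehlerFactor c z b * (-s + lam c z ^ 2 * b ^ 2)) z := by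
      have h3 := ((((hasDerivAt_id z).const_mul (-s))).add
        ((((h1.pow 2).const_sub 1).const_mul (b ^ 2)).div_const (4 * s))).cexp
      convert! h3 using 1
      simp only [mehlerFactor, ← hsdef]
      congr 1
      field_simp
      ring
    have h4 : HasDerivAt (fun z => gauss hs 0 (lam c z * b))
        ((-2 * s * lam c z * b) • gauss hs 1 (lam c z * b)) z :=
      HasDerivAt.scomp (g₁ := gauss hs 0) (h := fun z => lam c z * b) z
        (hasDerivAt_gauss hs 0 (lam c z * b)) (h1.mul_const b)
    convert! h2.smul h4 using 1
    module
  · have h := mem_oscillatorSubmodule.1 ((oscillatorSubmodule c).smul_mem (mehlerFactor c z b)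
      (mem_oscillatorSubmodule.2 (oscillatorGraph_gauss hs (sqrt_sq c) (lam c z * b))))
    convert h using 1
    module

theorem exists_isEntireOrbit {f : L2}
    (hf : f ∈ Submodule.span ℂ (Set.range (gauss (sqrt_re_pos hc) 0))) :
    ∃ F F', IsEntireOrbit hc f F F' := by
  induction hf using Submodule.span_induction with
  | mem f hf => obtain ⟨b, rfl⟩ := hf; exact exists_isEntireOrbit_gauss hc b
  | zero =>
    exact ⟨0, 0, fun z => hasDerivAt_const z 0, fun z => by
      rw [Pi.zero_apply, neg_zero]
      exact (oscillatorSubmodule c).zero_mem, fun τ _ => by simp⟩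
  | add f g _ _ hf hg =>
    obtain ⟨F, F', h1⟩ := hf
    obtain ⟨G, G', h2⟩ := hg
    refine ⟨F + G, F' + G', fun z => (h1.hasDerivAt z).add (h2.hasDerivAt z), fun z => ?_,
      fun τ hτ => by simp [h1.eq τ hτ, h2.eq τ hτ]⟩
    have := (oscillatorSubmodule c).add_mem (mem_oscillatorSubmodule.2 (h1.graph z))
      (mem_oscillatorSubmodule.2 (h2.graph z))
    rw [Pi.add_apply, Pi.add_apply, neg_add]
    exact this
  | smul a f _ hf =>
    obtain ⟨F, F', h1⟩ := hf
    refine ⟨a • F, a • F', fun z => (h1.hasDerivAt z).const_smul a, fun z => ?_,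
      fun τ hτ => by simp [h1.eq τ hτ]⟩
    have := (oscillatorSubmodule c).smul_mem a (mem_oscillatorSubmodule.2 (h1.graph z))
    rw [Pi.smul_apply, Pi.smul_apply, ← smul_neg]
    exact this

theorem ne_zero_of_mem_admissible {τ : ℂ} (hτ : τ ∈ admissible c) : τ ≠ 0 := by
  rintro rfl
  exact zero_notMem_admissible c hτ

theorem dissipative_of_mem_admissible {τ : ℂ} (hτ : τ ∈ admissible c) :
    ∀ p ∈ generatorSubmodule c τ, (inner ℂ p.1 p.2).re ≤ 0 :=
  generatorSubmodule_dissipative hτ.1 hτ.2.1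

theorem IsEntireOrbit.hasDerivAt_ray {f : L2} {F F' : ℂ → L2} (h : IsEntireOrbit hc f F F')
    (τ : ℂ) (t : ℝ) : HasDerivAt (fun t : ℝ => F (t * τ)) (τ • F' (t * τ)) t := by
  have h1 : HasDerivAt (fun t : ℝ => (t : ℂ) * τ) τ t := by
    simpa using (Complex.ofRealCLM.hasDerivAt (x := t)).mul_const τ
  exact (h.hasDerivAt (t * τ)).scomp t h1

theorem IsEntireOrbit.mem_ray {f : L2} {F F' : ℂ → L2} (h : IsEntireOrbit hc f F F')
    (τ z : ℂ) : (F z, τ • F' z) ∈ generatorSubmodule c τ :=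
  mem_generatorSubmodule.2 ⟨_, h.graph z, by simp⟩

theorem IsEntireOrbit.isClassicalOrbit {f : L2} {F F' : ℂ → L2} (h : IsEntireOrbit hc f F F')
    {τ : ℂ} (hτ : τ ∈ admissible c) :
    IsClassicalOrbit (fun t : ℝ => mehlerOp hc (t * τ)) (generatorSubmodule c τ)
      (fun t : ℝ => F (t * τ)) (fun t : ℝ => τ • F' (t * τ)) where
  eq t ht := by
    rw [Complex.ofReal_zero, zero_mul, h.apply_zero hc,
      h.eq _ (Set.mem_insert_of_mem _ (smul_mem_admissible hτ ht))]
  hasDerivAt t _ := h.hasDerivAt_ray hc τ t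
  mem t _ := h.mem_ray hc τ _

/-- On the Gaussian span, follow the orbit along the ray tτ from t = 0 to t = 1, where -τH_c is
dissipative; the general case is by density. -/
theorem norm_mehlerOp_apply_le {τ : ℂ} (hτ : τ ∈ insert 0 (admissible c)) (f : L2) :
    ‖mehlerOp hc τ f‖ ≤ ‖f‖ := by
  rcases hτ with rfl | hτ
  · simp [mehlerOp_zero]
  have hcl : IsClosed {f : L2 | ‖mehlerOp hc τ f‖ ≤ ‖f‖} :=
    isClosed_le (by fun_prop) (by fun_prop)
  refine hcl.closure_subset_iff.2 ?_ (dense_span_gauss (sqrt_re_pos hc) f)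
  intro g hg
  obtain ⟨F, F', h⟩ := exists_isEntireOrbit hc hg
  have := (h.isClassicalOrbit hc hτ).norm_le (dissipative_of_mem_admissible hτ) zero_le_one
  simpa [h.apply_zero hc, ← h.eq τ (Set.mem_insert_of_mem _ hτ)] using this

/-- By contractivity the orbit of f is a uniform limit of restrictions of entire orbits. Including 0
yields the strong limit at the vertex. -/
theorem continuousOn_mehlerOp_apply (f : L2) :
    ContinuousOn (fun τ => mehlerOp hc τ f) (insert 0 (admissible c)) := by
  refine continuousOn_of_uniform_approx_of_continuousOn fun u hu => ?_
  obtain ⟨ε, hε, hεu⟩ := Metric.mem_uniformity_dist.1 hu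
  obtain ⟨g, hg, hfg⟩ := Metric.mem_closure_iff.1 (dense_span_gauss (sqrt_re_pos hc) f) ε hε
  obtain ⟨F, F', h⟩ := exists_isEntireOrbit hc hg
  refine ⟨F, fun z _ => (h.hasDerivAt z).continuousAt.continuousWithinAt, fun τ hτ => hεu ?_⟩
  rw [← h.eq τ hτ, dist_eq_norm, ← map_sub]
  exact (norm_mehlerOp_apply_le hc hτ _).trans_lt (by rwa [← dist_eq_norm])

theorem differentiableOn_mehlerOp {V : Set ℂ} (hV : IsOpen V) (hsub : V ⊆ admissible c) :
    DifferentiableOn ℂ (mehlerOp hc) V := by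
  refine differentiableOn_of_apply hV zero_le_one (fun z hz =>
    ContinuousLinearMap.opNorm_le_bound _ zero_le_one fun f => by
      rw [one_mul]; exact norm_mehlerOp_apply_le hc (Set.mem_insert_of_mem _ (hsub hz)) f)
    fun f => ?_
  obtain ⟨g, hg, hgf⟩ := mem_closure_iff_seq_limit.1 (dense_span_gauss (sqrt_re_pos hc) f)
  choose F F' h using fun n => exists_isEntireOrbit hc (hg n)
  refine TendstoLocallyUniformlyOn.differentiableOn (F := F) (φ := atTop) ?_
    (Eventually.of_forall fun n z _ => ((h n).hasDerivAt z).differentiableAt.differentiableWithinAt)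
    hV
  refine TendstoUniformlyOn.tendstoLocallyUniformlyOn ?_
  rw [Metric.tendstoUniformlyOn_iff]
  intro ε hε
  filter_upwards [Metric.tendsto_nhds.1 hgf ε hε] with n hn z hz
  have hz' := Set.mem_insert_of_mem 0 (hsub hz)
  rw [← (h n).eq z hz', dist_comm, dist_eq_norm, ← map_sub]
  exact (norm_mehlerOp_apply_le hc hz' _).trans_lt (by rwa [← dist_eq_norm])

theorem isC0Semigroup_mehlerOp {τ : ℂ} (hτ : τ ∈ admissible c) :
    IsC0Semigroup (fun t : ℝ => mehlerOp hc (t * τ))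
      (fun f g => (f, g) ∈ generatorSubmodule c τ) := by
  refine isC0Semigroup_of_classicalOrbits (fun s t hs ht => ?_) (fun t ht => ?_) (fun f => ?_)
    (dissipative_of_mem_admissible hτ) (isClosed_generatorSubmodule hc (ne_zero_of_mem_admissible hτ)) ?_
  · rw [Complex.ofReal_add, add_mul]
    exact mehlerOp_add hc (smul_mem_admissible hτ hs) (smul_mem_admissible hτ ht)
  · refine ContinuousLinearMap.opNorm_le_bound _ zero_le_one fun f => ?_
    rw [one_mul]
    exact norm_mehlerOp_apply_le hc (Set.mem_insert_of_mem _ (smul_mem_admissible hτ ht)) f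
  · have h1 := continuousOn_mehlerOp_apply hc f 0 (Set.mem_insert _ _)
    have h2 : Tendsto (fun t : ℝ => (t : ℂ) * τ) (𝓝[>] 0) (𝓝[insert 0 (admissible c)] 0) := by
      refine tendsto_nhdsWithin_iff.2 ⟨?_, ?_⟩
      · have : Tendsto (fun t : ℝ => (t : ℂ) * τ) (𝓝 0) (𝓝 (((0 : ℝ) : ℂ) * τ)) :=
          Continuous.tendsto (by fun_prop) 0
        rw [Complex.ofReal_zero, zero_mul] at this
        exact this.mono_left nhdsWithin_le_nhds
      · filter_upwards [self_mem_nhdsWithin] with t ht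
        exact Set.mem_insert_of_mem _ (smul_mem_admissible hτ ht)
    have h3 := h1.tendsto.comp h2
    rw [mehlerOp_zero] at h3
    exact h3
  · refine (dense_span_gauss (sqrt_re_pos hc)).mono fun f hf => ?_
    obtain ⟨F, F', h⟩ := exists_isEntireOrbit hc hf
    exact ⟨_, _, h.isClassicalOrbit hc hτ, by simp [h.apply_zero hc]⟩

end Semigroup

/-! ### The maximal sector in terms of real parts. -/

section Sector

variable {c : ℂ}

theorem re_mul_eq (u τ : ℂ) : (u * τ).re = ‖u‖ * ‖τ‖ * Real.cos (u.arg + τ.arg) := by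
  rw [Real.cos_add, Complex.mul_re, ← Complex.norm_mul_cos_arg u, ← Complex.norm_mul_sin_arg u,
    ← Complex.norm_mul_cos_arg τ, ← Complex.norm_mul_sin_arg τ]
  ring

theorem openSector_subset_sector (c : ℂ) :
    openSector (lowerAngle c) (upperAngle c) ⊆ sector c := by
  intro τ hτ
  unfold sector
  split_ifs with h
  · exact hτ
  · exact ⟨hτ.1, hτ.2.1.le, hτ.2.2.le⟩

/-- On an edge Re τ or Re(cτ) may vanish, but arg(c^{1/2}τ) is the midpoint of arg τ and arg(cτ), so
it stays strictly inside (-π/2, π/2) when arg c ≠ 0. For real c the edges are excluded. -/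
theorem sector_subset_admissible (hc : 0 < c.re) : sector c ⊆ admissible c := by
  intro τ hτ
  have hα := abs_lt.1 (abs_arg_lt hc)
  have hs0 := ne_zero_of_re_pos (sqrt_re_pos hc)
  have key : τ ≠ 0 ∧ lowerAngle c ≤ τ.arg ∧ τ.arg ≤ upperAngle c ∧
      -(Real.pi / 2) < c.arg / 2 + τ.arg ∧ c.arg / 2 + τ.arg < Real.pi / 2 := by
    unfold sector at hτ
    split_ifs at hτ with h
    · have h0 : c.arg = 0 := Complex.arg_eq_zero_iff.2 ⟨hc.le, h⟩
      obtain ⟨h1, h2, h3⟩ := hτ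
      refine ⟨h1, h2.le, h3.le, ?_⟩
      simp only [lowerAngle, upperAngle, h0, min_self, max_self, sub_zero] at h2 h3
      rw [h0]
      constructor <;> linarith
    · have h0 : c.arg ≠ 0 := fun h' => h (Complex.arg_eq_zero_iff.1 h').2
      obtain ⟨h1, h2, h3⟩ := hτ
      refine ⟨h1, h2, h3, ?_⟩
      simp only [lowerAngle, upperAngle] at h2 h3
      rcases lt_or_gt_of_ne h0 with h0 | h0
      · rw [min_eq_left h0.le] at h2
        rw [max_eq_right h0.le] at h3
        constructor <;> linarith
      · rw [min_eq_right h0.le] at h2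
        rw [max_eq_left h0.le] at h3
        constructor <;> linarith
  obtain ⟨h0, h1, h2, h3, h4⟩ := key
  simp only [lowerAngle, upperAngle] at h1 h2
  have m1 := min_le_left c.arg 0
  have m2 := min_le_right c.arg 0
  have m3 := le_max_left c.arg 0
  have m4 := le_max_right c.arg 0
  refine ⟨?_, ?_, ?_⟩
  · rw [← Complex.norm_mul_cos_arg]
    exact mul_nonneg (norm_nonneg _) (Real.cos_nonneg_of_neg_pi_div_two_le_of_le
      (by linarith) (by linarith))
  · rw [re_mul_eq]
    exact mul_nonneg (by positivity) (Real.cos_nonneg_of_neg_pi_div_two_le_of_le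
      (by linarith) (by linarith))
  · rw [re_mul_eq, arg_sqrt hc]
    exact mul_pos (mul_pos (norm_pos_iff.2 hs0) (norm_pos_iff.2 h0))
      (Real.cos_pos_of_mem_Ioo ⟨h3, h4⟩)

/-- An open set between the interior of the maximal sector and the admissible set. -/
def openAdmissible (c : ℂ) : Set ℂ :=
  {τ | 0 < τ.re ∧ 0 < (c * τ).re ∧ 0 < (c ^ (1 / 2 : ℂ) * τ).re}

theorem isOpen_openAdmissible (c : ℂ) : IsOpen (openAdmissible c) :=
  (isOpen_lt continuous_const Complex.continuous_re).inter
    ((isOpen_lt continuous_const (Complex.continuous_re.comp (continuous_const_mul c))).inter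
      (isOpen_lt continuous_const
        (Complex.continuous_re.comp (continuous_const_mul (c ^ (1 / 2 : ℂ))))))

theorem openAdmissible_subset (c : ℂ) : openAdmissible c ⊆ admissible c :=
  fun _ h => ⟨h.1.le, h.2.1.le, h.2.2⟩

theorem openSector_subset_openAdmissible (hc : 0 < c.re) :
    openSector (lowerAngle c) (upperAngle c) ⊆ openAdmissible c := by
  intro τ hτ
  have h3 := (sector_subset_admissible hc (openSector_subset_sector c hτ)).2.2
  obtain ⟨h0, h1, h2⟩ := hτ
  simp only [lowerAngle, upperAngle] at h1 h2
  have m1 := min_le_left c.arg 0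
  have m2 := min_le_right c.arg 0
  have m3 := le_max_left c.arg 0
  have m4 := le_max_right c.arg 0
  refine ⟨?_, ?_, h3⟩
  · rw [← Complex.norm_mul_cos_arg]
    exact mul_pos (norm_pos_iff.2 h0) (Real.cos_pos_of_mem_Ioo ⟨by linarith, by linarith⟩)
  · rw [re_mul_eq]
    exact mul_pos (mul_pos (norm_pos_iff.2 (ne_zero_of_re_pos hc)) (norm_pos_iff.2 h0))
      (Real.cos_pos_of_mem_Ioo ⟨by linarith, by linarith⟩)

theorem sector_smul {τ : ℂ} (hτ : τ ∈ sector c) {t : ℝ} (ht : 0 < t) : (t : ℂ) * τ ∈ sector c := by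
  unfold sector at hτ ⊢
  have ht' : (t : ℂ) ≠ 0 := by exact_mod_cast ht.ne'
  split_ifs at hτ ⊢ with h
  · obtain ⟨h1, h2⟩ := hτ
    exact ⟨mul_ne_zero ht' h1, by rwa [Complex.arg_real_mul _ ht]⟩
  · obtain ⟨h1, h2⟩ := hτ
    exact ⟨mul_ne_zero ht' h1, by rwa [Complex.arg_real_mul _ ht]⟩

end Sector

/-! ### Existence, uniqueness and the theorem. -/

variable {c : ℂ}

theorem isOscillatorSemigroup_mehlerOp (hc : 0 < c.re) :
    IsOscillatorSemigroup c (mehlerOp hc) where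
  holomorphicSemigroup :=
    { add := fun z hz w hw => mehlerOp_add hc
        (openAdmissible_subset c (openSector_subset_openAdmissible hc hz))
        (openAdmissible_subset c (openSector_subset_openAdmissible hc hw))
      contraction := fun z hz => ContinuousLinearMap.opNorm_le_bound _ zero_le_one fun f => by
        rw [one_mul]
        exact norm_mehlerOp_apply_le hc (Set.mem_insert_of_mem _
          (openAdmissible_subset c (openSector_subset_openAdmissible hc hz))) f
      holomorphic := (differentiableOn_mehlerOp hc (isOpen_openAdmissible c)
        (openAdmissible_subset c)).mono (openSector_subset_openAdmissible hc)
      tendsto_zero := fun f ε hε => by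
        have h := (continuousOn_mehlerOp_apply hc f 0 (Set.mem_insert _ _)).tendsto
        rw [mehlerOp_zero] at h
        refine h.mono_left (nhdsWithin_mono 0 fun z hz => Set.mem_insert_of_mem _ ?_)
        refine openAdmissible_subset c (openSector_subset_openAdmissible hc
          ⟨hz.1, ?_, ?_⟩)
        · linarith [hz.2.1]
        · linarith [hz.2.2] }
  generator := fun τ hτ => by
    simpa only [mem_generatorSubmodule] using
      isC0Semigroup_mehlerOp hc (sector_subset_admissible hc hτ)
  strongContinuous := fun f => (continuousOn_mehlerOp_apply hc f).mono
    ((sector_subset_admissible hc).trans (Set.subset_insert _ _))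

/-- The Gaussian orbits along the ray of τ are classical solutions for -τH_c, so T must follow them
up to time 1; edges are handled like interior rays. -/
theorem IsOscillatorSemigroup.eq_mehlerOp (hc : 0 < c.re) {T : ℂ → L2 →L[ℂ] L2}
    (hT : IsOscillatorSemigroup c T) {τ : ℂ} (hτ : τ ∈ sector c) : T τ = mehlerOp hc τ := by
  have hadm := sector_subset_admissible hc hτ
  refine ContinuousLinearMap.ext_on (dense_span_gauss (sqrt_re_pos hc)) ?_
  rintro _ ⟨b, rfl⟩
  obtain ⟨F, F', h⟩ := exists_isEntireOrbit_gauss hc b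
  have hgen : IsC0Semigroup (fun t : ℝ => T (t * τ))
      (fun f g => (f, g) ∈ generatorSubmodule c τ) := by
    simpa only [mem_generatorSubmodule] using hT.generator τ hτ
  have := hgen.apply_eq (fun f => (hT.strongContinuous f).comp (s := Set.Ioi 0)
    (f := fun t : ℝ => (t : ℂ) * τ) (by fun_prop) fun t ht => sector_smul hτ ht) (dissipative_of_mem_admissible hadm)
    (fun t _ => h.hasDerivAt_ray hc τ t) (fun t _ => h.mem_ray hc τ (t * τ)) one_pos
  simpa [h.apply_zero hc, ← h.eq τ (Set.mem_insert_of_mem _ hadm)] using this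

end Oscillator

theorem theoremt3 (c : ℂ) (hc : 0 < c.re) :
    (∃ T : ℂ → Oscillator.L2 →L[ℂ] Oscillator.L2, Oscillator.IsOscillatorSemigroup c T) ∧
    ∀ T : ℂ → Oscillator.L2 →L[ℂ] Oscillator.L2, Oscillator.IsOscillatorSemigroup c T →
      ∀ τ ∈ Oscillator.sector c,
        (∀ f : Oscillator.L2,
          (∀ x : ℝ, Integrable (fun y : ℝ => Oscillator.kernel c τ x y * f y) volume) ∧
          ∀ᵐ x : ℝ, (T τ f) x = ∫ y : ℝ, Oscillator.kernel c τ x y * f y) ∧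
        Oscillator.IsHilbertSchmidt (T τ) ∧
        IsCompactOperator (T τ) := by
  refine ⟨⟨_, Oscillator.isOscillatorSemigroup_mehlerOp hc⟩, fun T hT τ hτ => ?_⟩
  obtain ⟨h1, h2⟩ := Oscillator.mehlerOp_spec hc (Oscillator.sector_subset_admissible hc hτ)
  rw [hT.eq_mehlerOp hc hτ]
  exact ⟨h2, h1, h1.isCompactOperator⟩
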